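/- Let $\varepsilon,\delta\ge 1$, and let $V,W$ be smooth ($C^\infty$) real functions on a neighbourhood of $[0,1]$ that map $[0,1]$ into $[0,1]$ and satisfy $V(0)=W(0)=0$. Consider the planar system $$b'=V(g)-\varepsilon b,\qquad g'=W(b)-\delta g ,$$ and suppose that it has only finitely many fixed points in the unit square, i.e. that $\{(b,g)\in[0,1]^2:\ \varepsilon b=V(g),\ \delta g=W(b)\}$ is finite. The type of a fixed point is understood through the two complex eigenvalues (with algebraic multiplicity) of the linearization: a stable node has two real negative eigenvalues (possibly equal), a stable spiral has two conjugate non-real eigenvalues with negative real part, a saddle has one negative and one positive eigenvalue, and a fixed point is of saddle-node type if one eigenvalue is zero and the other is negative. A (one-dimensional, local) center manifold of a fixed point $p$ is an injective $C^1$ curve $\gamma:(-\eta,\eta)\to\mathbb R^2$, $\eta>0$, with nowhere vanishing velocity and $\gamma(0)=p$, whose tangent line at $p$ is the center subspace of the linearization (the real vectors in the sum of the generalized eigenspaces of the eigenvalues with zero real part) and which is locally invariant: the vector field is tangent to it at each of its points. Its two branches are $\gamma((0,\eta))$ and $\gamma((-\eta,0))$. A branch converges to $p$ (diverges from $p$)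 if, near $p$, it is a half-trajectory of a solution that tends to $p$ as $t\to+\infty$ (respectively as $t\to-\infty$). If $p$ lies on the boundary of the square, these notions refer to the system on a neighbourhood of the square. Then every fixed point in the square has at least one eigenvalue with negative real part, so that none is repelling, and it is a stable node, a stable spiral, a saddle, or of saddle-node type; in the last case, each branch of any center manifold of the point that is contained in $[0,1]^2$ near the point either converges to it or diverges from it. Moreover, for every fixed point $(b_0,g_0)$ in the square: 1. $(b_0,g_0)$ is a stable node or a stable spiral if and only if $V'(g_0)W'(b_0)<\varepsilon\delta$; 2. $(b_0,g_0)$ is a saddle if and only if $V'(g_0)W'(b_0)>\varepsilon\delta$; 3. $(b_0,g_0)$ has a center manifold if and only if $V'(g_0)W'(b_0)=\varepsilon\delta$. If in this case $$V''(g_0)\,W'(b_0)+\tfrac1\varepsilon\,(V'(g_0))^2\,W''(b_0)\neq 0 ,$$ then, for every center manifold of $(b_0,g_0)$, one of its two branches converges to $(b_0,g_0)$ and the other one diverges from $(b_0,g_0)$. -/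

import Mathlib

open Set Filter Topology
open scoped ContDiff

noncomputable section

namespace PlatformModel

/-! ### Planar vector fields: linearization -/

/-- The Jacobian matrix of a planar vector field at a point. -/
def jacobian (F : ℝ × ℝ → ℝ × ℝ) (p : ℝ × ℝ) : Matrix (Fin 2) (Fin 2) ℝ :=
  LinearMap.toMatrix (Module.Basis.finTwoProd ℝ) (Module.Basis.finTwoProd ℝ)
    (fderiv ℝ F p : ℝ × ℝ →ₗ[ℝ] ℝ × ℝ)

/-- The Jacobian matrix, regarded as a complex matrix. -/
def complexJacobian (F : ℝ × ℝ → ℝ × ℝ) (p : ℝ × ℝ) : Matrix (Fin 2) (Fin 2) ℂ :=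
  (jacobian F p).map (algebraMap ℝ ℂ)

/-- The two complex eigenvalues of the linearization, with algebraic multiplicity. -/
def eigenvalues (F : ℝ × ℝ → ℝ × ℝ) (p : ℝ × ℝ) : Multiset ℂ :=
  (complexJacobian F p).charpoly.roots

/-- Stable node: both eigenvalues are real and negative (possibly equal). -/
def IsStableNode (F : ℝ × ℝ → ℝ × ℝ) (p : ℝ × ℝ) : Prop :=
  ∃ μ ν : ℝ, μ < 0 ∧ ν < 0 ∧ eigenvalues F p = {(μ : ℂ), (ν : ℂ)}

/-- Stable spiral: a pair of conjugate non-real eigenvalues with negative real part. -/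
def IsStableSpiral (F : ℝ × ℝ → ℝ × ℝ) (p : ℝ × ℝ) : Prop :=
  ∃ μ θ : ℝ, μ < 0 ∧ 0 < θ ∧ eigenvalues F p = {(⟨μ, θ⟩ : ℂ), (⟨μ, -θ⟩ : ℂ)}

/-- Saddle: one negative and one positive eigenvalue. -/
def IsSaddle (F : ℝ × ℝ → ℝ × ℝ) (p : ℝ × ℝ) : Prop :=
  ∃ μ ν : ℝ, μ < 0 ∧ 0 < ν ∧ eigenvalues F p = {(μ : ℂ), (ν : ℂ)}

/-- Linearization of saddle-node type: one eigenvalue is zero, the other one is negative. -/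
def IsSaddleNodeType (F : ℝ × ℝ → ℝ × ℝ) (p : ℝ × ℝ) : Prop :=
  ∃ μ : ℝ, μ < 0 ∧ eigenvalues F p = {(0 : ℂ), (μ : ℂ)}

/-- The inclusion of the real plane into the complex plane `ℂ²`. -/
def complexify : ℝ × ℝ →ₗ[ℝ] (Fin 2 → ℂ) where
  toFun v := ![(v.1 : ℂ), (v.2 : ℂ)]
  map_add' v w := by ext i; fin_cases i <;> simp
  map_smul' c v := by ext i; fin_cases i <;> simp

/-- The center subspace of the linearization: the real vectors in the sum of the generalized
eigenspaces that belong to the eigenvalues with zero real part. -/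
def centerSubspace (F : ℝ × ℝ → ℝ × ℝ) (p : ℝ × ℝ) : Submodule ℝ (ℝ × ℝ) :=
  ((⨆ z : {z : ℂ // z.re = 0},
    Module.End.maxGenEigenspace (Matrix.toLin' (complexJacobian F p)) z.1).restrictScalars
      ℝ).comap complexify

/-! ### One-dimensional local center manifolds and their branches -/

/-- The curve `γ`, on the interval `(-η, η)`, is a (one-dimensional) local center manifold of the
field `F` at `p`: an injective `C¹` curve with nowhere vanishing velocity that passes through `p`
at parameter `0`, whose tangent line at `p` is the center subspace of the linearization, and which
is locally invariant, i.e. the field is tangent to it at each of its points. -/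
structure IsLocalCenterManifold (F : ℝ × ℝ → ℝ × ℝ) (p : ℝ × ℝ) (η : ℝ) (γ : ℝ → ℝ × ℝ) :
    Prop where
  pos : 0 < η
  contDiffOn : ContDiffOn ℝ 1 γ (Ioo (-η) η)
  injOn : InjOn γ (Ioo (-η) η)
  base : γ 0 = p
  deriv_ne_zero : ∀ s ∈ Ioo (-η) η, deriv γ s ≠ 0
  tangent : Submodule.span ℝ {deriv γ 0} = centerSubspace F p
  invariant : ∀ s ∈ Ioo (-η) η, F (γ s) ∈ Submodule.span ℝ {deriv γ s}

/-- The branch `γ (0, η)` converges to `p`: near `p` it is the forward half-trajectory of a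
solution of `x' = F x` which tends to `p` as `t → +∞`. -/
def BranchConverges (F : ℝ × ℝ → ℝ × ℝ) (p : ℝ × ℝ) (η : ℝ) (γ : ℝ → ℝ × ℝ) : Prop :=
  ∃ r ∈ Ioo 0 η, ∃ x : ℝ → ℝ × ℝ,
    IsIntegralCurveOn x (fun _ => F) (Ici 0) ∧
    x 0 = γ r ∧ x '' Ici 0 = γ '' Ioc 0 r ∧ Tendsto x atTop (𝓝 p)

/-- The branch `γ (0, η)` diverges from `p`: near `p` it is the backward half-trajectory of a
solution of `x' = F x` which tends to `p` as `t → -∞`; so, in forward time, the solution moves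
away from `p` along the branch. -/
def BranchDiverges (F : ℝ × ℝ → ℝ × ℝ) (p : ℝ × ℝ) (η : ℝ) (γ : ℝ → ℝ × ℝ) : Prop :=
  ∃ r ∈ Ioo 0 η, ∃ x : ℝ → ℝ × ℝ,
    IsIntegralCurveOn x (fun _ => F) (Iic 0) ∧
    x 0 = γ r ∧ x '' Iic 0 = γ '' Ioc 0 r ∧ Tendsto x atBot (𝓝 p)

/-! ### The two-sided platform model -/

/-- The vector field `b' = V(g) - ε b`, `g' = W(b) - δ g`, at the point `(b, g)`. -/
def field (ε δ : ℝ) (V W : ℝ → ℝ) (p : ℝ × ℝ) : ℝ × ℝ :=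
  (V p.2 - ε * p.1, W p.1 - δ * p.2)

/-- The unit square. -/
def square : Set (ℝ × ℝ) := Icc 0 1 ×ˢ Icc 0 1

/-- The fixed points of the model in the unit square. -/
def fixedPoints (ε δ : ℝ) (V W : ℝ → ℝ) : Set (ℝ × ℝ) :=
  {p ∈ square | ε * p.1 = V p.2 ∧ δ * p.2 = W p.1}

end PlatformModel

end

noncomputable section

namespace PlatformModel

/-! ### The linearization of the platform model -/

/-! The linearization at a fixed point has trace `-(ε + δ) < 0` and determinant `εδ - V'W'`. A 2×2
spectrum is determined by trace and determinant (`eigenvalues_field_eq_pair_iff`), so the sign of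
the determinant decides the type: positive gives a stable node or spiral (according to the
discriminant), negative a saddle, zero the pair `0, -(ε + δ)`. A purely imaginary eigenvalue other
than `0` would contradict the nonzero trace. Hence the center subspace is trivial unless the
determinant vanishes, and then it is the line through `(V', ε)`.

Along a center manifold `γ` the field equals `α(s) γ'(s)`, so the flow on a branch is the scalar
equation `s' = α(s)`. Since `|α(s)| ≤ C s`, the point `s = 0` is not reached in finite time, and a
sign of `α` on `(0, r]` decides between convergence and divergence. If the branch lies in the
square, finiteness of the fixed points there prevents `α` from vanishing near `0`, and continuity
fixes its sign. If the quadratic expression `Q` of part 3 is nonzero, pair the field with the left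
null vector `l` of the Jacobian: `l` kills the linear part, and `l(F(γ(s)))` is `s²` times a nonzero
limit with the sign of `Q`. That sign is the same on both branches, whereas the outgoing velocities
are opposite. So one branch converges and the other diverges.

Existence of a center manifold when the determinant vanishes is the long part. In eigencoordinates
the system is `x' = X`, `y' = -lam y + R` with `X`, `R` of second order, and an invariant graph `y =
φ(x)` is a stationary solution of `∂ₜφ + X ∂ₓφ = -lam φ + R`. Rescaling makes `X`, `R` small in
`C^{1,1}`, and a correction away from the origin makes `X` point outward near the ends of `[-1, 1]`.
An implicit Euler step then preserves a fixed `C^{1,1}` class and contracts the sup distance;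
letting the step size tend to `0` gives the graph (`exists_invariant_graph`, `exists_center_graph`,
`exists_isLocalCenterManifold`). -/

lemma hasFDerivAt_field {ε δ : ℝ} {V W : ℝ → ℝ} {p : ℝ × ℝ}
    (hV : DifferentiableAt ℝ V p.2) (hW : DifferentiableAt ℝ W p.1) :
    HasFDerivAt (field ε δ V W)
      ((deriv V p.2 • ContinuousLinearMap.snd ℝ ℝ ℝ - ε • ContinuousLinearMap.fst ℝ ℝ ℝ).prod
        (deriv W p.1 • ContinuousLinearMap.fst ℝ ℝ ℝ - δ • ContinuousLinearMap.snd ℝ ℝ ℝ)) p := by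
  have h1 : HasFDerivAt (fun q : ℝ × ℝ => V q.2)
      (deriv V p.2 • ContinuousLinearMap.snd ℝ ℝ ℝ) p :=
    hV.hasDerivAt.comp_hasFDerivAt p hasFDerivAt_snd
  have h2 : HasFDerivAt (fun q : ℝ × ℝ => W q.1)
      (deriv W p.1 • ContinuousLinearMap.fst ℝ ℝ ℝ) p :=
    hW.hasDerivAt.comp_hasFDerivAt p hasFDerivAt_fst
  exact (h1.sub (hasFDerivAt_fst.const_mul ε)).prodMk (h2.sub (hasFDerivAt_snd.const_mul δ))

lemma jacobian_field {ε δ : ℝ} {V W : ℝ → ℝ} {p : ℝ × ℝ}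
    (hV : DifferentiableAt ℝ V p.2) (hW : DifferentiableAt ℝ W p.1) :
    jacobian (field ε δ V W) p = !![-ε, deriv V p.2; deriv W p.1, -δ] := by
  rw [jacobian, (hasFDerivAt_field hV hW).fderiv]
  ext i j
  fin_cases i <;> fin_cases j <;> simp [LinearMap.toMatrix_apply]

lemma complexJacobian_field {ε δ : ℝ} {V W : ℝ → ℝ} {p : ℝ × ℝ}
    (hV : DifferentiableAt ℝ V p.2) (hW : DifferentiableAt ℝ W p.1) :
    complexJacobian (field ε δ V W) p =
      !![-(ε : ℂ), ((deriv V p.2 : ℝ) : ℂ); ((deriv W p.1 : ℝ) : ℂ), -(δ : ℂ)] := by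
  rw [complexJacobian, jacobian_field hV hW]
  ext i j
  fin_cases i <;> fin_cases j <;> simp

lemma roots_charpoly_eq_pair_iff {K : Type*} [Field K] [IsAlgClosed K]
    (M : Matrix (Fin 2) (Fin 2) K) (a b : K) :
    M.charpoly.roots = {a, b} ↔ a + b = M.trace ∧ a * b = M.det := by
  constructor
  · intro h
    rw [Matrix.trace_eq_sum_roots_charpoly_of_splits (IsAlgClosed.splits _),
      Matrix.det_eq_prod_roots_charpoly_of_splits (IsAlgClosed.splits _), h]
    simp
  · rintro ⟨h1, h2⟩
    have : M.charpoly = (Polynomial.X - Polynomial.C a) * (Polynomial.X - Polynomial.C b) := by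
      rw [Matrix.charpoly_fin_two, ← h1, ← h2, Polynomial.C_add, Polynomial.C_mul]
      ring
    rw [this, Polynomial.roots_mul (mul_ne_zero (Polynomial.X_sub_C_ne_zero a)
      (Polynomial.X_sub_C_ne_zero b)), Polynomial.roots_X_sub_C, Polynomial.roots_X_sub_C]
    rfl

lemma eigenvalues_field_eq_pair_iff {ε δ : ℝ} {V W : ℝ → ℝ} {p : ℝ × ℝ}
    (hV : DifferentiableAt ℝ V p.2) (hW : DifferentiableAt ℝ W p.1) (a b : ℂ) :
    eigenvalues (field ε δ V W) p = {a, b} ↔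
      a + b = ((-(ε + δ) : ℝ) : ℂ) ∧ a * b = ((ε * δ - deriv V p.2 * deriv W p.1 : ℝ) : ℂ) := by
  rw [eigenvalues, complexJacobian_field hV hW, roots_charpoly_eq_pair_iff]
  simp only [Matrix.trace_fin_two_of, Matrix.det_fin_two_of]
  push_cast
  constructor <;> rintro ⟨h1, h2⟩ <;> exact ⟨by rw [h1]; ring, by rw [h2]; ring⟩

lemma exists_real_pair {s d : ℝ} (h : 0 ≤ s ^ 2 - 4 * d) :
    ∃ μ ν : ℝ, μ ≤ ν ∧ μ + ν = s ∧ μ * ν = d := by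
  refine ⟨(s - √(s ^ 2 - 4 * d)) / 2, (s + √(s ^ 2 - 4 * d)) / 2, ?_, by ring, ?_⟩
  · linarith [Real.sqrt_nonneg (s ^ 2 - 4 * d)]
  · linear_combination (-1 / 4) * Real.sq_sqrt h

lemma stable_iff {ε δ : ℝ} {V W : ℝ → ℝ} {p : ℝ × ℝ} (hs : 0 < ε + δ)
    (hV : DifferentiableAt ℝ V p.2) (hW : DifferentiableAt ℝ W p.1) :
    (IsStableNode (field ε δ V W) p ∨ IsStableSpiral (field ε δ V W) p) ↔
      deriv V p.2 * deriv W p.1 < ε * δ := by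
  simp only [IsStableNode, IsStableSpiral, eigenvalues_field_eq_pair_iff hV hW]
  constructor
  · rintro (⟨μ, ν, hμ, hν, -, h⟩ | ⟨μ, θ, hμ, hθ, -, h⟩)
    · have h' : μ * ν = ε * δ - deriv V p.2 * deriv W p.1 := by exact_mod_cast h
      nlinarith [mul_pos_of_neg_of_neg hμ hν]
    · have h' := congrArg Complex.re h
      simp only [Complex.mul_re, Complex.ofReal_re] at h'
      nlinarith [sq_nonneg μ, mul_pos hθ hθ]
  · intro h
    rcases le_or_gt 0 ((-(ε + δ)) ^ 2 - 4 * (ε * δ - deriv V p.2 * deriv W p.1)) with hd | hd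
    · left
      obtain ⟨μ, ν, h0, h1, h2⟩ := exists_real_pair hd
      have hμ : μ < 0 := by linarith
      refine ⟨μ, ν, hμ, ?_, by exact_mod_cast h1, by exact_mod_cast h2⟩
      by_contra hν
      nlinarith [mul_nonneg (neg_nonneg.2 hμ.le) (not_lt.1 hν)]
    · right
      have hpos : 0 < (4 * (ε * δ - deriv V p.2 * deriv W p.1) - (ε + δ) ^ 2) / 4 := by
        nlinarith
      refine ⟨-(ε + δ) / 2, √((4 * (ε * δ - deriv V p.2 * deriv W p.1) - (ε + δ) ^ 2) / 4),
        by linarith, Real.sqrt_pos.2 hpos, ?_, ?_⟩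
      · apply Complex.ext <;> simp [-Complex.ofReal_neg, -Complex.ofReal_add]
      · apply Complex.ext
        · simp only [Complex.mul_re, Complex.ofReal_re]
          linear_combination Real.mul_self_sqrt hpos.le
        · simp only [Complex.mul_im, Complex.ofReal_im]
          ring

lemma isSaddle_iff {ε δ : ℝ} {V W : ℝ → ℝ} {p : ℝ × ℝ}
    (hV : DifferentiableAt ℝ V p.2) (hW : DifferentiableAt ℝ W p.1) :
    IsSaddle (field ε δ V W) p ↔ deriv V p.2 * deriv W p.1 > ε * δ := by
  simp only [IsSaddle, eigenvalues_field_eq_pair_iff hV hW]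
  constructor
  · rintro ⟨μ, ν, hμ, hν, -, h⟩
    have h' : μ * ν = ε * δ - deriv V p.2 * deriv W p.1 := by exact_mod_cast h
    nlinarith [mul_neg_of_neg_of_pos hμ hν]
  · intro h
    obtain ⟨μ, ν, h0, h1, h2⟩ := exists_real_pair (s := -(ε + δ))
      (d := ε * δ - deriv V p.2 * deriv W p.1) (by nlinarith [sq_nonneg (-(ε + δ))])
    have hneg : μ * ν < 0 := by linarith
    rcases mul_neg_iff.1 hneg with ⟨h3, h4⟩ | ⟨h3, h4⟩
    · linarith
    · exact ⟨μ, ν, h3, h4, by exact_mod_cast h1, by exact_mod_cast h2⟩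

lemma isSaddleNodeType_of_eq {ε δ : ℝ} {V W : ℝ → ℝ} {p : ℝ × ℝ} (hs : 0 < ε + δ)
    (hV : DifferentiableAt ℝ V p.2) (hW : DifferentiableAt ℝ W p.1)
    (h : deriv V p.2 * deriv W p.1 = ε * δ) : IsSaddleNodeType (field ε δ V W) p := by
  refine ⟨-(ε + δ), by linarith, ?_⟩
  rw [eigenvalues_field_eq_pair_iff hV hW, h]
  simp

lemma exists_eigenvalue_re_neg {F : ℝ × ℝ → ℝ × ℝ} {p : ℝ × ℝ}
    (h : IsStableNode F p ∨ IsStableSpiral F p ∨ IsSaddle F p ∨ IsSaddleNodeType F p) :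
    ∃ z ∈ eigenvalues F p, z.re < 0 := by
  rcases h with ⟨μ, ν, hμ, -, h⟩ | ⟨μ, θ, hμ, -, h⟩ | ⟨μ, ν, hμ, -, h⟩ | ⟨μ, hμ, h⟩
  · exact ⟨μ, by simp [h], by simpa⟩
  · exact ⟨⟨μ, θ⟩, by simp [h], by simpa⟩
  · exact ⟨μ, by simp [h], by simpa⟩
  · exact ⟨μ, by simp [h], by simpa⟩

/-! ### The center subspace -/

lemma maxGenEigenspace_eq_bot {a b c d z : ℂ} (h : (a - z) * (d - z) - b * c ≠ 0) :
    Module.End.maxGenEigenspace (Matrix.toLin' !![a, b; c, d]) z = ⊥ := by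
  have hinj : Function.Injective (Matrix.toLin' !![a, b; c, d] - z • (1 : Module.End ℂ (Fin 2 → ℂ))) := by
    refine (injective_iff_map_eq_zero _).2 fun x hx => ?_
    have h0 := congrFun hx 0
    have h1 := congrFun hx 1
    simp [dotProduct, Fin.sum_univ_two] at h0 h1
    ext i
    fin_cases i
    · refine (mul_eq_zero.1 (?_ : ((a - z) * (d - z) - b * c) * x 0 = 0)).resolve_left h
      linear_combination (d - z) * h0 - b * h1
    · refine (mul_eq_zero.1 (?_ : ((a - z) * (d - z) - b * c) * x 1 = 0)).resolve_left h
      linear_combination (a - z) * h1 - c * h0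
  rw [eq_bot_iff]
  intro x hx
  obtain ⟨k, hk⟩ := (Module.End.mem_maxGenEigenspace _ _ _).1 hx
  rw [Module.End.coe_pow] at hk
  exact (hinj.iterate k) (hk.trans (Function.iterate_fixed (map_zero _) k).symm)

/-- By Cayley–Hamilton with zero determinant, `f² = (a + d) f`. All powers of `f` are then nonzero
multiples of `f`, so `0` is a semisimple eigenvalue. -/
lemma maxGenEigenspace_zero_eq_ker {a b c d : ℂ} (h : a * d - b * c = 0) (ht : a + d ≠ 0) :
    Module.End.maxGenEigenspace (Matrix.toLin' !![a, b; c, d]) 0 =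
      LinearMap.ker (Matrix.toLin' !![a, b; c, d]) := by
  set f := Matrix.toLin' !![a, b; c, d] with hf
  have hsq : ∀ x, f (f x) = (a + d) • f x := by
    intro x
    ext i
    fin_cases i <;> simp [hf, Matrix.mulVec, dotProduct, Fin.sum_univ_two]
    · linear_combination (-x 0) * h
    · linear_combination (-x 1) * h
  have hpow : ∀ (k : ℕ) x, (f ^ (k + 1)) x = (a + d) ^ k • f x := by
    intro k
    induction k with
    | zero => intro x; simp
    | succ k ih => intro x; rw [pow_succ, Module.End.mul_apply, ih, hsq, smul_smul, ← pow_succ]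
  ext x
  rw [Module.End.mem_maxGenEigenspace, LinearMap.mem_ker]
  constructor
  · rintro ⟨k, hk⟩
    have h1 : (f ^ (k + 1)) x = 0 := by
      rw [zero_smul, sub_zero] at hk
      rw [pow_succ', Module.End.mul_apply, hk, map_zero]
    rw [hpow] at h1
    exact (smul_eq_zero.1 h1).resolve_left (pow_ne_zero _ ht)
  · intro hx
    exact ⟨1, by simpa using hx⟩

/-- For purely imaginary `z`, the imaginary part of the characteristic polynomial at `z` is `(ε + δ)
Im z`. A root on the imaginary axis must therefore be `0`, which forces the determinant to vanish.
-/
lemma centerSubspace_field_eq_bot {ε δ : ℝ} {V W : ℝ → ℝ} {p : ℝ × ℝ} (hs : 0 < ε + δ)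
    (hV : DifferentiableAt ℝ V p.2) (hW : DifferentiableAt ℝ W p.1)
    (h : deriv V p.2 * deriv W p.1 ≠ ε * δ) : centerSubspace (field ε δ V W) p = ⊥ := by
  have hbot : (⨆ z : {z : ℂ // z.re = 0}, Module.End.maxGenEigenspace
      (Matrix.toLin' (complexJacobian (field ε δ V W) p)) z.1) = ⊥ := by
    rw [iSup_eq_bot]
    rintro ⟨z, hz⟩
    rw [complexJacobian_field hV hW]
    refine maxGenEigenspace_eq_bot fun h0 => ?_
    have hre := congrArg Complex.re h0
    have him := congrArg Complex.im h0
    simp [hz] at hre him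
    have him' : (ε + δ) * z.im = 0 := by linear_combination him
    have hz0 : z.im = 0 := (mul_eq_zero.1 him').resolve_left hs.ne'
    rw [hz0] at hre
    exact h (by linarith)
  rw [centerSubspace, hbot, eq_bot_iff]
  intro x hx
  have hx' : complexify x = 0 := by simpa using hx
  have h0 := congrFun hx' 0
  have h1 := congrFun hx' 1
  simp [complexify] at h0 h1
  exact (Submodule.mem_bot ℝ).2 (Prod.ext h0 h1)

lemma centerSubspace_field_eq_span {ε δ : ℝ} {V W : ℝ → ℝ} {p : ℝ × ℝ} (hε : 0 < ε) (hδ : 0 < δ)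
    (hV : DifferentiableAt ℝ V p.2) (hW : DifferentiableAt ℝ W p.1)
    (h : deriv V p.2 * deriv W p.1 = ε * δ) :
    centerSubspace (field ε δ V W) p = Submodule.span ℝ {(deriv V p.2, ε)} := by
  have hC : ((deriv V p.2 : ℝ) : ℂ) * ((deriv W p.1 : ℝ) : ℂ) = ε * δ := by exact_mod_cast h
  have hker : (⨆ z : {z : ℂ // z.re = 0}, Module.End.maxGenEigenspace
      (Matrix.toLin' (complexJacobian (field ε δ V W) p)) z.1) =
      LinearMap.ker (Matrix.toLin' (complexJacobian (field ε δ V W) p)) := by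
    rw [complexJacobian_field hV hW]
    have h0 : -(ε : ℂ) * -(δ : ℂ) - ((deriv V p.2 : ℝ) : ℂ) * ((deriv W p.1 : ℝ) : ℂ) = 0 := by rw [hC]; ring
    have ht : -(ε : ℂ) + -(δ : ℂ) ≠ 0 := by
      intro h1
      have : -ε + -δ = 0 := by exact_mod_cast h1
      linarith
    rw [← maxGenEigenspace_zero_eq_ker h0 ht]
    refine le_antisymm (iSup_le ?_) (le_iSup_of_le (⟨0, rfl⟩ : {z : ℂ // z.re = 0}) le_rfl)
    rintro ⟨z, hz⟩
    by_cases hz0 : z = 0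
    · simp [hz0]
    · refine le_of_eq_of_le (maxGenEigenspace_eq_bot fun h1 => ?_) bot_le
      have h2 : z * (z - (-(ε : ℂ) + -(δ : ℂ))) = 0 := by linear_combination h1 - h0
      have h3 := congrArg Complex.re ((mul_eq_zero.1 h2).resolve_left hz0)
      simp [hz] at h3
      linarith
  ext x
  have hv : deriv V p.2 ≠ 0 := fun h1 => by
    rw [h1, zero_mul] at h; exact (mul_pos hε hδ).ne h
  have hmem : x ∈ centerSubspace (field ε δ V W) p ↔
      Matrix.toLin' (complexJacobian (field ε δ V W) p) (complexify x) = 0 := by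
    rw [centerSubspace, hker]; rfl
  rw [hmem, complexJacobian_field hV hW, Submodule.mem_span_singleton]
  constructor
  · intro hx
    have h0 := congrFun hx 0
    simp [complexify, Matrix.mulVec, dotProduct, Fin.sum_univ_two] at h0
    have h0' : -(ε * x.1) + deriv V p.2 * x.2 = 0 := by exact_mod_cast h0
    refine ⟨x.2 / ε, Prod.ext ?_ ?_⟩
    · simp only [Prod.smul_mk, smul_eq_mul]
      field_simp
      linarith
    · simp only [Prod.smul_mk, smul_eq_mul]
      field_simp
  · rintro ⟨c, rfl⟩
    ext i
    fin_cases i <;> simp [complexify, Matrix.mulVec, dotProduct, Fin.sum_univ_two]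
    · ring
    · linear_combination (c : ℂ) * hC

/-! ### Reparametrization of invariant curves by time -/

/-- Separation of variables: `τ` is the inverse of the primitive of `a`. The lower bound `c` makes
that primitive a bijection of the line, so the solution is global. Only continuity of `a` is needed.
-/
lemma exists_autonomous_solution {a : ℝ → ℝ} (ha : Continuous a) {c : ℝ} (hc : 0 < c)
    (hca : ∀ y, c ≤ a y) (y₀ : ℝ) :
    ∃ τ : ℝ → ℝ, τ 0 = y₀ ∧ StrictMono τ ∧ Function.Surjective τ ∧
      ∀ t, HasDerivAt τ (a (τ t))⁻¹ t := by
  set H : ℝ → ℝ := fun y => ∫ s in y₀..y, a s with hH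
  have hd : ∀ y, HasDerivAt H (a y) y := fun y => (ha.integral_hasStrictDerivAt y₀ y).hasDerivAt
  have hcont : Continuous H := continuous_iff_continuousAt.2 fun y => (hd y).continuousAt
  have hmono : StrictMono H :=
    strictMono_of_deriv_pos fun y => by rw [(hd y).deriv]; exact hc.trans_le (hca y)
  have hmono' : Monotone fun y => H y - c * y := by
    have hd' : ∀ y, HasDerivAt (fun y => H y - c * y) (a y - c) y := fun y => by
      have h := (hd y).sub ((hasDerivAt_id y).const_mul c)
      rw [mul_one] at h
      exact h
    exact monotone_of_deriv_nonneg (fun y => (hd' y).differentiableAt)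
      fun y => by rw [(hd' y).deriv]; exact sub_nonneg.2 (hca y)
  have hH0 : H y₀ = 0 := by simp [hH]
  have hlin : Tendsto (fun y => c * y - c * y₀) atTop atTop :=
    tendsto_atTop_add_const_right _ _ (tendsto_id.const_mul_atTop hc)
  have hlin' : Tendsto (fun y => c * y - c * y₀) atBot atBot :=
    tendsto_atBot_add_const_right _ _ (tendsto_id.const_mul_atBot hc)
  have hsurj : Function.Surjective H := by
    refine hcont.surjective (tendsto_atTop_mono' _ ?_ hlin) (tendsto_atBot_mono' _ ?_ hlin')
    · filter_upwards [eventually_ge_atTop y₀] with y hy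
      have := hmono' hy
      simp only [hH0] at this
      linarith
    · filter_upwards [eventually_le_atBot y₀] with y hy
      have := hmono' hy
      simp only [hH0] at this
      linarith
  set e := hmono.orderIsoOfSurjective H hsurj with he
  have heH : ∀ y, e y = H y := fun y => rfl
  refine ⟨e.symm, ?_, e.symm.strictMono, e.symm.surjective, fun t => ?_⟩
  · rw [OrderIso.symm_apply_eq, heH, hH0]
  · refine HasDerivAt.of_local_left_inverse e.symm.continuous.continuousAt (hd _)
      (hc.trans_le (hca _)).ne' (Eventually.of_forall fun y => ?_)
    rw [← heH]
    exact e.apply_symm_apply y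

/-- In the variable `y = -log s` the equation `s' = α(s)` becomes `y' = -α(s) / s`, with speed
positive and at most `C`. The linear bound thus excludes arrival at `0` in finite time. -/
lemma exists_solution_tendsto_zero {α : ℝ → ℝ} {r C : ℝ} (hr : 0 < r)
    (hα : ContinuousOn α (Ioc 0 r)) (hneg : ∀ s ∈ Ioc 0 r, α s < 0)
    (hC : ∀ s ∈ Ioc 0 r, -α s ≤ C * s) :
    ∃ σ : ℝ → ℝ, σ 0 = r ∧ (∀ t ∈ Ici (0 : ℝ), HasDerivAt σ (α (σ t)) t) ∧
      σ '' Ici 0 = Ioc 0 r ∧ Tendsto σ atTop (𝓝 0) := by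
  have hCpos : 0 < C := by
    have h1 := hneg r ⟨hr, le_rfl⟩
    have h2 := hC r ⟨hr, le_rfl⟩
    by_contra h
    nlinarith
  -- The truncation keeps `e y` in `(0, r]` for every real `y`, so the coefficient is defined on the
  -- whole line. It is inactive for `t ≥ 0`, where `τ t ≥ -log r`.
  set e : ℝ → ℝ := fun y => Real.exp (-max y (-Real.log r)) with he
  have he_mem : ∀ y, e y ∈ Ioc 0 r := fun y => ⟨Real.exp_pos _, by
    calc e y ≤ Real.exp (Real.log r) := Real.exp_le_exp.2 (by linarith [le_max_right y (-Real.log r)])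
      _ = r := Real.exp_log hr⟩
  have he_cont : Continuous e := by fun_prop
  have hcomp : Continuous fun y => α (e y) := hα.comp_continuous he_cont he_mem
  have ha : Continuous fun y => e y / -α (e y) :=
    he_cont.div hcomp.neg fun y => (neg_pos.2 (hneg _ (he_mem y))).ne'
  obtain ⟨τ, h0, hmono, hsurj, hd⟩ := exists_autonomous_solution ha (inv_pos.2 hCpos)
    (fun y => by
      rw [le_div_iff₀ (neg_pos.2 (hneg _ (he_mem y))), inv_mul_le_iff₀ hCpos]
      exact hC _ (he_mem y)) (-Real.log r)
  have hge : ∀ t ∈ Ici (0 : ℝ), -Real.log r ≤ τ t := fun t ht => h0 ▸ hmono.monotone ht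
  have heq : ∀ t ∈ Ici (0 : ℝ), e (τ t) = Real.exp (-τ t) := fun t ht => by
    simp only [he, max_eq_left (hge t ht)]
  refine ⟨fun t => Real.exp (-τ t), ?_, fun t ht => ?_, ?_, ?_⟩
  · simp [h0, Real.exp_log hr]
  · have h : HasDerivAt (fun t => Real.exp (-τ t))
        (Real.exp (-τ t) * -(e (τ t) / -α (e (τ t)))⁻¹) t := (hd t).neg.exp
    rw [heq t ht] at h
    convert h using 1
    have := (hneg _ (he_mem (τ t))).ne
    rw [heq t ht] at this
    have h2 := (Real.exp_pos (-τ t)).ne'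
    field_simp
  · ext s
    constructor
    · rintro ⟨t, ht, rfl⟩
      have := he_mem (τ t)
      rwa [heq t ht] at this
    · rintro ⟨hs0, hsr⟩
      obtain ⟨t, ht⟩ := hsurj (-Real.log s)
      refine ⟨t, ?_, by simp [ht, Real.exp_log hs0]⟩
      refine hmono.le_iff_le.1 ?_
      rw [h0, ht]
      exact neg_le_neg (Real.log_le_log hs0 hsr)
  · refine Real.tendsto_exp_neg_atTop_nhds_zero.comp ?_
    exact tendsto_atTop_atTop.2 fun b => by
      obtain ⟨t, ht⟩ := hsurj b
      exact ⟨t, fun u hu => ht ▸ hmono.monotone hu⟩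

lemma branchConverges_of_tangent {F : ℝ × ℝ → ℝ × ℝ} {p : ℝ × ℝ} {η r C : ℝ} {γ : ℝ → ℝ × ℝ}
    {α : ℝ → ℝ} (hr : r ∈ Ioo 0 η) (hα : ContinuousOn α (Ioc 0 r))
    (hneg : ∀ s ∈ Ioc 0 r, α s < 0) (hC : ∀ s ∈ Ioc 0 r, -α s ≤ C * s)
    (hγ : ∀ s ∈ Ioc 0 r, DifferentiableAt ℝ γ s)
    (hF : ∀ s ∈ Ioc 0 r, F (γ s) = α s • deriv γ s) (hp : Tendsto γ (𝓝[>] 0) (𝓝 p)) :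
    BranchConverges F p η γ := by
  obtain ⟨σ, h0, hd, himg, ht⟩ := exists_solution_tendsto_zero hr.1 hα hneg hC
  have hmem : ∀ t ∈ Ici (0 : ℝ), σ t ∈ Ioc 0 r := fun t h => himg ▸ mem_image_of_mem σ h
  refine ⟨r, hr, γ ∘ σ, fun t h => ?_, by simp [h0], by rw [image_comp, himg], ?_⟩
  · change HasDerivWithinAt _ (F (γ (σ t))) _ _
    rw [hF _ (hmem t h)]
    exact ((hγ _ (hmem t h)).hasDerivAt.scomp t (hd t h)).hasDerivWithinAt
  · refine hp.comp (tendsto_nhdsWithin_iff.2 ⟨ht, ?_⟩)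
    filter_upwards [eventually_ge_atTop 0] with t h using (hmem t h).1

/-- Time reversal: the scalar equation is solved forward for `-α`, then `t` is replaced by `-t`. -/
lemma branchDiverges_of_tangent {F : ℝ × ℝ → ℝ × ℝ} {p : ℝ × ℝ} {η r C : ℝ} {γ : ℝ → ℝ × ℝ}
    {α : ℝ → ℝ} (hr : r ∈ Ioo 0 η) (hα : ContinuousOn α (Ioc 0 r))
    (hpos : ∀ s ∈ Ioc 0 r, 0 < α s) (hC : ∀ s ∈ Ioc 0 r, α s ≤ C * s)
    (hγ : ∀ s ∈ Ioc 0 r, DifferentiableAt ℝ γ s)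
    (hF : ∀ s ∈ Ioc 0 r, F (γ s) = α s • deriv γ s) (hp : Tendsto γ (𝓝[>] 0) (𝓝 p)) :
    BranchDiverges F p η γ := by
  obtain ⟨σ, h0, hd, himg, ht⟩ := exists_solution_tendsto_zero (α := fun s => -α s) hr.1 hα.neg
    (fun s hs => neg_neg_of_pos (hpos s hs)) (fun s hs => (neg_neg (α s)).symm ▸ hC s hs)
  have hmem : ∀ t ∈ Ici (0 : ℝ), σ t ∈ Ioc 0 r := fun t h => himg ▸ mem_image_of_mem σ h
  have hneg : ∀ t ∈ Iic (0 : ℝ), -t ∈ Ici (0 : ℝ) := fun t h => neg_nonneg.2 (mem_Iic.1 h)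
  refine ⟨r, hr, fun t => γ (σ (-t)), fun t h => ?_, by simp [h0], ?_, ?_⟩
  · have h1 : HasDerivAt (fun t => σ (-t)) (α (σ (-t))) t := by
      have h2 := (hd (-t) (hneg t h)).scomp t (hasDerivAt_neg t)
      rw [smul_eq_mul, neg_mul_neg, one_mul] at h2
      exact h2
    change HasDerivWithinAt _ (F (γ (σ (-t)))) _ _
    rw [hF _ (hmem _ (hneg t h))]
    exact ((hγ _ (hmem _ (hneg t h))).hasDerivAt.scomp t h1).hasDerivWithinAt
  · rw [← himg, image_image]
    ext q
    constructor
    · rintro ⟨t, h, rfl⟩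
      exact ⟨-t, hneg t h, rfl⟩
    · rintro ⟨t, h, rfl⟩
      exact ⟨-t, neg_nonpos.2 (mem_Ici.1 h), by simp⟩
  · have h1 : Tendsto (fun t => σ (-t)) atBot (𝓝[>] 0) := by
      refine tendsto_nhdsWithin_iff.2 ⟨ht.comp tendsto_neg_atBot_atTop, ?_⟩
      filter_upwards [eventually_le_atBot 0] with t h using (hmem _ (hneg t h)).1
    exact hp.comp h1

/-! ### Branches of center manifolds -/

/-- Lets every statement on the branch with positive parameter apply to the other one as well. -/
lemma IsLocalCenterManifold.comp_neg {F : ℝ × ℝ → ℝ × ℝ} {p : ℝ × ℝ} {η : ℝ} {γ : ℝ → ℝ × ℝ}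
    (h : IsLocalCenterManifold F p η γ) : IsLocalCenterManifold F p η (fun s => γ (-s)) := by
  have hmem : ∀ s ∈ Ioo (-η) η, -s ∈ Ioo (-η) η := fun s hs =>
    ⟨by linarith [hs.2], by linarith [hs.1]⟩
  have hd : ∀ s, deriv (fun s => γ (-s)) s = -deriv γ (-s) := fun s => deriv_comp_neg γ s
  refine ⟨h.pos, h.contDiffOn.comp contDiff_neg.contDiffOn hmem, ?_, by simp [h.base], ?_, ?_, ?_⟩
  · intro s hs t ht hst
    exact neg_injective (h.injOn (hmem s hs) (hmem t ht) hst)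
  · intro s hs
    rw [hd]
    exact neg_ne_zero.2 (h.deriv_ne_zero _ (hmem s hs))
  · rw [hd, ← h.tangent, neg_zero, ← Set.neg_singleton, Submodule.span_neg]
  · intro s hs
    rw [hd, ← Set.neg_singleton, Submodule.span_neg]
    exact h.invariant _ (hmem s hs)

/-- Near the base point the field along a center manifold is a small multiple `α` of the
velocity. The multiple is read off by a linear form that does not vanish on the velocity. -/
lemma IsLocalCenterManifold.exists_tangent_factor {F : ℝ × ℝ → ℝ × ℝ} {p : ℝ × ℝ} {η : ℝ}
    {γ : ℝ → ℝ × ℝ} (h : IsLocalCenterManifold F p η γ) (hFp : F p = 0)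
    (hFd : DifferentiableAt ℝ F p) (hFc : ∀ᶠ q in 𝓝 p, ContinuousAt F q)
    (l : ℝ × ℝ →L[ℝ] ℝ) (hl : l (deriv γ 0) ≠ 0) :
    ∃ (r₀ C : ℝ) (α : ℝ → ℝ), 0 < r₀ ∧ r₀ < η ∧ ContinuousOn α (Ioc 0 r₀) ∧
      (∀ s ∈ Ioc 0 r₀, |α s| ≤ C * s) ∧ (∀ s ∈ Ioc 0 r₀, DifferentiableAt ℝ γ s) ∧
      (∀ s ∈ Ioc 0 r₀, F (γ s) = α s • deriv γ s) ∧
      (∀ s ∈ Ioc 0 r₀, 0 < α s ↔ 0 < l (F (γ s)) / l (deriv γ 0)) ∧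
      Tendsto γ (𝓝[>] 0) (𝓝 p) := by
  have h0 : (0 : ℝ) ∈ Ioo (-η) η := ⟨neg_lt_zero.2 h.pos, h.pos⟩
  have hnhds : ∀ s ∈ Ioo (-η) η, Ioo (-η) η ∈ 𝓝 s := fun s hs => isOpen_Ioo.mem_nhds hs
  have hdiff : ∀ s ∈ Ioo (-η) η, DifferentiableAt ℝ γ s := fun s hs =>
    (h.contDiffOn.differentiableOn one_ne_zero).differentiableAt (hnhds s hs)
  have hderiv : ContinuousOn (deriv γ) (Ioo (-η) η) :=
    h.contDiffOn.continuousOn_deriv_of_isOpen isOpen_Ioo le_rfl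
  have hγ0 : Tendsto γ (𝓝 0) (𝓝 p) := h.base ▸ (hdiff 0 h0).continuousAt
  have hO : (fun s => F (γ s)) =O[𝓝 0] fun s : ℝ => s := by
    have h1 : (fun s => F (γ s)) =O[𝓝 0] fun s => γ s - p := by
      have := hFd.isBigO_sub.comp_tendsto hγ0
      simpa [hFp, Function.comp_def] using this
    have h2 : (fun s => γ s - p) =O[𝓝 0] fun s : ℝ => s := by
      simpa [h.base] using (hdiff 0 h0).isBigO_sub
    exact h1.trans h2
  obtain ⟨C, hC⟩ := hO.bound
  -- Near the base point `l(γ'(s))` keeps the sign of `l(γ'(0))` and at least half its size. This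
  -- makes `α` well defined, bounds it by a multiple of `s`, and ties its sign to that of
  -- `l(F(γ(s)))`.
  have hl' : ∀ᶠ s in 𝓝 (0 : ℝ), 1 / 2 < l (deriv γ s) / l (deriv γ 0) := by
    have h1 : Tendsto (fun s => l (deriv γ s) / l (deriv γ 0)) (𝓝 0) (𝓝 1) := by
      rw [← div_self hl]
      exact ((l.continuous.tendsto _).comp (hderiv.continuousAt (hnhds 0 h0))).div_const _
    exact h1.eventually_const_lt (by norm_num)
  obtain ⟨r₁, hr₁, hr⟩ := Metric.eventually_nhds_iff.1
    (((hC.and hl').and (hγ0.eventually hFc)).and (hnhds 0 h0))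
  have hr' : ∀ s ∈ Ioc 0 (r₁ / 2), ((‖F (γ s)‖ ≤ C * ‖s‖ ∧
      1 / 2 < l (deriv γ s) / l (deriv γ 0)) ∧ ContinuousAt F (γ s)) ∧ s ∈ Ioo (-η) η :=
    fun s hs => hr (by rw [Real.dist_eq, sub_zero, abs_of_pos hs.1]; linarith [hs.2])
  have hlne : ∀ s ∈ Ioc 0 (r₁ / 2), l (deriv γ s) ≠ 0 := fun s hs h1 => by
    have := (hr' s hs).1.1.2
    rw [h1] at this
    norm_num at this
  refine ⟨r₁ / 2, 2 * (‖l‖ * C) / |l (deriv γ 0)|, fun s => l (F (γ s)) / l (deriv γ s),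
    half_pos hr₁, (hr' (r₁ / 2) ⟨half_pos hr₁, le_rfl⟩).2.2, ?_, ?_,
    fun s hs => hdiff s (hr' s hs).2, ?_, ?_, hγ0.mono_left nhdsWithin_le_nhds⟩
  · refine ContinuousOn.div ?_ ?_ hlne
    · intro s hs
      exact (l.continuous.continuousAt.comp (ContinuousAt.comp (hr' s hs).1.2
        (hdiff s (hr' s hs).2).continuousAt)).continuousWithinAt
    · exact l.continuous.comp_continuousOn (hderiv.mono fun s hs => (hr' s hs).2)
  · intro s hs
    obtain ⟨⟨⟨h1, h2⟩, -⟩, -⟩ := hr' s hs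
    have hpos : 0 < |l (deriv γ 0)| := abs_pos.2 hl
    have h3 : |l (deriv γ 0)| / 2 ≤ |l (deriv γ s)| := by
      have h4 : 1 / 2 ≤ |l (deriv γ s)| / |l (deriv γ 0)| := by
        rw [← abs_div]
        exact h2.le.trans (le_abs_self _)
      rw [le_div_iff₀ hpos] at h4
      linarith
    have h5 : |l (F (γ s))| ≤ ‖l‖ * C * s := by
      calc |l (F (γ s))| ≤ ‖l‖ * ‖F (γ s)‖ := l.le_opNorm _
        _ ≤ ‖l‖ * (C * ‖s‖) := by gcongr
        _ = ‖l‖ * C * s := by rw [Real.norm_of_nonneg hs.1.le]; ring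
    rw [abs_div]
    calc |l (F (γ s))| / |l (deriv γ s)| ≤ (‖l‖ * C * s) / (|l (deriv γ 0)| / 2) := by
          gcongr
          exact (abs_nonneg _).trans h5
      _ = 2 * (‖l‖ * C) / |l (deriv γ 0)| * s := by field_simp
  · intro s hs
    obtain ⟨c, hc⟩ := Submodule.mem_span_singleton.1 (h.invariant s (hr' s hs).2)
    change F (γ s) = (l (F (γ s)) / l (deriv γ s)) • deriv γ s
    rw [← hc, map_smul, smul_eq_mul, mul_div_cancel_right₀ _ (hlne s hs)]
  · intro s hs
    have h1 : l (F (γ s)) / l (deriv γ s) =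
        (l (F (γ s)) / l (deriv γ 0)) / (l (deriv γ s) / l (deriv γ 0)) := by
      rw [div_div_div_cancel_right₀ hl]
    change 0 < l (F (γ s)) / l (deriv γ s) ↔ _
    rw [h1]
    exact div_pos_iff_of_pos_right (by linarith [(hr' s hs).1.1.2])

lemma exists_Ioc_of_eventually_nhdsGT {P : ℝ → Prop} (h : ∀ᶠ s in 𝓝[>] (0 : ℝ), P s) {r₀ : ℝ}
    (hr₀ : 0 < r₀) : ∃ r, 0 < r ∧ r ≤ r₀ ∧ ∀ s ∈ Ioc 0 r, P s := by
  obtain ⟨u, hu, hsub⟩ := mem_nhdsGT_iff_exists_Ioc_subset.1 h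
  exact ⟨min u r₀, lt_min hu hr₀, min_le_right _ _,
    fun s hs => hsub ⟨hs.1, hs.2.trans (min_le_left _ _)⟩⟩

lemma IsLocalCenterManifold.branchDiverges {F : ℝ × ℝ → ℝ × ℝ} {p : ℝ × ℝ} {η : ℝ}
    {γ : ℝ → ℝ × ℝ} (h : IsLocalCenterManifold F p η γ) (hFp : F p = 0)
    (hFd : DifferentiableAt ℝ F p) (hFc : ∀ᶠ q in 𝓝 p, ContinuousAt F q)
    (l : ℝ × ℝ →L[ℝ] ℝ) (hl : l (deriv γ 0) ≠ 0)
    (hpos : ∀ᶠ s in 𝓝[>] (0 : ℝ), 0 < l (F (γ s)) / l (deriv γ 0)) :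
    BranchDiverges F p η γ := by
  obtain ⟨r₀, C, α, hr₀, hη, hα, hC, hd, hF, hsign, hp⟩ :=
    h.exists_tangent_factor hFp hFd hFc l hl
  obtain ⟨r, hr, hrr, hP⟩ := exists_Ioc_of_eventually_nhdsGT hpos hr₀
  have hsub : Ioc 0 r ⊆ Ioc 0 r₀ := Ioc_subset_Ioc_right hrr
  exact branchDiverges_of_tangent ⟨hr, hrr.trans_lt hη⟩ (hα.mono hsub)
    (fun s hs => (hsign s (hsub hs)).2 (hP s hs))
    (fun s hs => (le_abs_self _).trans (hC s (hsub hs))) (fun s hs => hd s (hsub hs))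
    (fun s hs => hF s (hsub hs)) hp

lemma IsLocalCenterManifold.branchConverges {F : ℝ × ℝ → ℝ × ℝ} {p : ℝ × ℝ} {η : ℝ}
    {γ : ℝ → ℝ × ℝ} (h : IsLocalCenterManifold F p η γ) (hFp : F p = 0)
    (hFd : DifferentiableAt ℝ F p) (hFc : ∀ᶠ q in 𝓝 p, ContinuousAt F q)
    (l : ℝ × ℝ →L[ℝ] ℝ) (hl : l (deriv γ 0) ≠ 0)
    (hneg : ∀ᶠ s in 𝓝[>] (0 : ℝ), l (F (γ s)) / l (deriv γ 0) < 0) :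
    BranchConverges F p η γ := by
  obtain ⟨r₀, C, α, hr₀, hη, hα, hC, hd, hF, hsign, hp⟩ :=
    h.exists_tangent_factor hFp hFd hFc l hl
  obtain ⟨r, hr, hrr, hP⟩ := exists_Ioc_of_eventually_nhdsGT hneg hr₀
  have hsub : Ioc 0 r ⊆ Ioc 0 r₀ := Ioc_subset_Ioc_right hrr
  refine branchConverges_of_tangent ⟨hr, hrr.trans_lt hη⟩ (hα.mono hsub)
    (fun s hs => lt_of_le_of_ne (not_lt.1 fun h1 => ?_) fun h1 => ?_)
    (fun s hs => (neg_le_abs _).trans (hC s (hsub hs))) (fun s hs => hd s (hsub hs))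
    (fun s hs => hF s (hsub hs)) hp
  · exact (hP s hs).not_gt ((hsign s (hsub hs)).1 h1)
  · have h2 := hP s hs
    rw [hF s (hsub hs), h1, zero_smul, map_zero, zero_div] at h2
    exact lt_irrefl _ h2

lemma IsLocalCenterManifold.branchConverges_or_branchDiverges {F : ℝ × ℝ → ℝ × ℝ} {p : ℝ × ℝ}
    {η : ℝ} {γ : ℝ → ℝ × ℝ} (h : IsLocalCenterManifold F p η γ) (hFp : F p = 0)
    (hFd : DifferentiableAt ℝ F p) (hFc : ∀ᶠ q in 𝓝 p, ContinuousAt F q)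
    (l : ℝ × ℝ →L[ℝ] ℝ) (hl : l (deriv γ 0) ≠ 0)
    (hne : ∀ᶠ s in 𝓝[>] (0 : ℝ), F (γ s) ≠ 0) :
    BranchConverges F p η γ ∨ BranchDiverges F p η γ := by
  obtain ⟨r₀, C, α, hr₀, hη, hα, hC, hd, hF, -, hp⟩ :=
    h.exists_tangent_factor hFp hFd hFc l hl
  obtain ⟨r, hr, hrr, hP⟩ := exists_Ioc_of_eventually_nhdsGT hne hr₀
  have hsub : Ioc 0 r ⊆ Ioc 0 r₀ := Ioc_subset_Ioc_right hrr
  have hα0 : ∀ s ∈ Ioc 0 r, α s ≠ 0 := fun s hs h1 =>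
    hP s hs (by rw [hF s (hsub hs), h1, zero_smul])
  -- A continuous function without zeros on an interval has constant sign.
  have hdich : (∀ s ∈ Ioc 0 r, α s < 0) ∨ ∀ s ∈ Ioc 0 r, 0 < α s := by
    by_contra! hcon
    obtain ⟨⟨s, hs, hs0⟩, t, ht, ht0⟩ := hcon
    obtain ⟨u, hu, hu0⟩ := isPreconnected_Ioc.intermediate_value ht hs (hα.mono hsub) ⟨ht0, hs0⟩
    exact hα0 u hu hu0
  rcases hdich with hneg | hpos
  · exact Or.inl (branchConverges_of_tangent ⟨hr, hrr.trans_lt hη⟩ (hα.mono hsub) hneg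
      (fun s hs => (neg_le_abs _).trans (hC s (hsub hs))) (fun s hs => hd s (hsub hs))
      (fun s hs => hF s (hsub hs)) hp)
  · exact Or.inr (branchDiverges_of_tangent ⟨hr, hrr.trans_lt hη⟩ (hα.mono hsub) hpos
      (fun s hs => (le_abs_self _).trans (hC s (hsub hs))) (fun s hs => hd s (hsub hs))
      (fun s hs => hF s (hsub hs)) hp)

/-! ### Slow invariant graphs by a discrete graph transform -/

/-- `X` and its differential `D` vanish at the origin, and `X` is `C^{1,1}` on the unit ball of the
plane, with all bounds at most `e`. -/
structure IsSmallC11 (X : ℝ × ℝ → ℝ) (D : ℝ × ℝ → ℝ × ℝ →L[ℝ] ℝ) (e : ℝ) : Prop where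
  zero : X 0 = 0
  fderiv_zero : D 0 = 0
  lipschitz : ∀ p q, ‖p‖ ≤ 1 → ‖q‖ ≤ 1 → |X q - X p| ≤ e * ‖q - p‖
  fderiv_le : ∀ p, ‖p‖ ≤ 1 → ‖D p‖ ≤ e
  taylor : ∀ p q, ‖p‖ ≤ 1 → ‖q‖ ≤ 1 → |X q - X p - D p (q - p)| ≤ e * ‖q - p‖ ^ 2

/-- `φ` is a `C^{1,1}` function on `[-1, 1]` with derivative `ψ`, vanishing to first order at `0`,
with bounds independent of all data. -/
structure IsC11Graph (φ ψ : ℝ → ℝ) : Prop where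
  zero : φ 0 = 0
  deriv_zero : ψ 0 = 0
  lipschitz : ∀ x y, |x| ≤ 1 → |y| ≤ 1 → |φ y - φ x| ≤ |y - x|
  deriv_le : ∀ x, |x| ≤ 1 → |ψ x| ≤ 1
  taylor : ∀ x y, |x| ≤ 1 → |y| ≤ 1 → |φ y - φ x - ψ x * (y - x)| ≤ |y - x| ^ 2

/-- The foot of the backward Euler step along the graph of `φ`. -/
def graphFoot (X : ℝ × ℝ → ℝ) (h : ℝ) (φ : ℝ → ℝ) (x : ℝ) : ℝ := x - h * X (x, φ x)

/-- One implicit Euler step for `∂ₜ φ + X ∂ₓ φ = -lam φ + R`. -/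
def graphStep (X R : ℝ × ℝ → ℝ) (lam h : ℝ) (φ : ℝ → ℝ) (x : ℝ) : ℝ :=
  (φ (graphFoot X h φ x) + h * R (x, φ x)) / (1 + lam * h)

lemma IsSmallC11.add {X Y : ℝ × ℝ → ℝ} {D E : ℝ × ℝ → ℝ × ℝ →L[ℝ] ℝ} {d e : ℝ}
    (hX : IsSmallC11 X D d) (hY : IsSmallC11 Y E e) :
    IsSmallC11 (fun p => X p + Y p) (fun p => D p + E p) (d + e) where
  zero := by simp [hX.zero, hY.zero]
  fderiv_zero := by simp [hX.fderiv_zero, hY.fderiv_zero]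
  lipschitz p q hp hq := by
    have h1 := hX.lipschitz p q hp hq
    have h2 := hY.lipschitz p q hp hq
    calc |X q + Y q - (X p + Y p)| = |(X q - X p) + (Y q - Y p)| := by ring_nf
      _ ≤ |X q - X p| + |Y q - Y p| := abs_add_le _ _
      _ ≤ (d + e) * ‖q - p‖ := by linarith
  fderiv_le p hp := (norm_add_le _ _).trans (add_le_add (hX.fderiv_le p hp) (hY.fderiv_le p hp))
  taylor p q hp hq := by
    have h1 := hX.taylor p q hp hq
    have h2 := hY.taylor p q hp hq
    calc |X q + Y q - (X p + Y p) - (D p + E p) (q - p)|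
        = |(X q - X p - D p (q - p)) + (Y q - Y p - E p (q - p))| := by
          rw [add_apply]; ring_nf
      _ ≤ |X q - X p - D p (q - p)| + |Y q - Y p - E p (q - p)| := abs_add_le _ _
      _ ≤ (d + e) * ‖q - p‖ ^ 2 := by linarith

lemma IsSmallC11.mono {X : ℝ × ℝ → ℝ} {D : ℝ × ℝ → ℝ × ℝ →L[ℝ] ℝ} {d e : ℝ}
    (hX : IsSmallC11 X D d) (h : d ≤ e) : IsSmallC11 X D e where
  zero := hX.zero
  fderiv_zero := hX.fderiv_zero
  lipschitz p q hp hq := (hX.lipschitz p q hp hq).trans (by gcongr)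
  fderiv_le p hp := (hX.fderiv_le p hp).trans h
  taylor p q hp hq := (hX.taylor p q hp hq).trans (by gcongr)

lemma IsSmallC11.nonneg {X : ℝ × ℝ → ℝ} {D : ℝ × ℝ → ℝ × ℝ →L[ℝ] ℝ} {e : ℝ}
    (hX : IsSmallC11 X D e) : 0 ≤ e := (norm_nonneg _).trans (hX.fderiv_le 0 (by simp))

lemma IsSmallC11.abs_apply_le {X : ℝ × ℝ → ℝ} {D : ℝ × ℝ → ℝ × ℝ →L[ℝ] ℝ} {e : ℝ}
    (hX : IsSmallC11 X D e) {p : ℝ × ℝ} (hp : ‖p‖ ≤ 1) : |X p| ≤ e := by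
  have := hX.lipschitz 0 p (by simp) hp
  rw [hX.zero, sub_zero, sub_zero] at this
  exact this.trans (mul_le_of_le_one_right hX.nonneg hp)

lemma IsC11Graph.abs_apply_le {φ ψ : ℝ → ℝ} (hφ : IsC11Graph φ ψ) {x : ℝ} (hx : |x| ≤ 1) :
    |φ x| ≤ 1 := by
  have := hφ.lipschitz 0 x (by simp) hx
  rw [hφ.zero, sub_zero, sub_zero] at this
  exact this.trans hx

lemma IsC11Graph.norm_le {φ ψ : ℝ → ℝ} (hφ : IsC11Graph φ ψ) {x : ℝ} (hx : |x| ≤ 1) :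
    ‖(x, φ x)‖ ≤ 1 := by
  rw [Prod.norm_def]
  exact max_le hx (hφ.abs_apply_le hx)

/-- The plane carries the sup norm, so lifting to a 1-Lipschitz graph does not increase distances,
and no extra constants appear below. -/
lemma IsC11Graph.norm_sub_le {φ ψ : ℝ → ℝ} (hφ : IsC11Graph φ ψ) {x y : ℝ} (hx : |x| ≤ 1)
    (hy : |y| ≤ 1) : ‖(y, φ y) - (x, φ x)‖ ≤ |y - x| := by
  rw [Prod.norm_def]
  exact max_le le_rfl (hφ.lipschitz x y hx hy)

lemma IsC11Graph.abs_comp_sub_le {φ ψ : ℝ → ℝ} (hφ : IsC11Graph φ ψ) {X : ℝ × ℝ → ℝ}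
    {D : ℝ × ℝ → ℝ × ℝ →L[ℝ] ℝ} {e : ℝ} (hX : IsSmallC11 X D e) {x y : ℝ} (hx : |x| ≤ 1)
    (hy : |y| ≤ 1) : |X (y, φ y) - X (x, φ x)| ≤ e * |y - x| :=
  (hX.lipschitz _ _ (hφ.norm_le hx) (hφ.norm_le hy)).trans
    (mul_le_mul_of_nonneg_left (hφ.norm_sub_le hx hy) hX.nonneg)

lemma IsC11Graph.abs_fderiv_le {φ ψ : ℝ → ℝ} (hφ : IsC11Graph φ ψ) {X : ℝ × ℝ → ℝ}
    {D : ℝ × ℝ → ℝ × ℝ →L[ℝ] ℝ} {e : ℝ} (hX : IsSmallC11 X D e) {x : ℝ} (hx : |x| ≤ 1) :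
    |D (x, φ x) (1, ψ x)| ≤ e := by
  have h1 : ‖((1 : ℝ), ψ x)‖ ≤ 1 := by
    rw [Prod.norm_def]
    exact max_le (by simp) (hφ.deriv_le x hx)
  calc |D (x, φ x) (1, ψ x)| ≤ ‖D (x, φ x)‖ * ‖((1 : ℝ), ψ x)‖ := (D (x, φ x)).le_opNorm _
    _ ≤ e * 1 := mul_le_mul (hX.fderiv_le _ (hφ.norm_le hx)) h1 (norm_nonneg _) hX.nonneg
    _ = e := mul_one e

/-- Of the constant `2 * e`, one `e` is the Taylor remainder of `X`; the other is its differential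
applied to the Taylor remainder of `φ`. -/
lemma IsC11Graph.abs_comp_taylor_le {φ ψ : ℝ → ℝ} (hφ : IsC11Graph φ ψ) {X : ℝ × ℝ → ℝ}
    {D : ℝ × ℝ → ℝ × ℝ →L[ℝ] ℝ} {e : ℝ} (hX : IsSmallC11 X D e) {x y : ℝ} (hx : |x| ≤ 1)
    (hy : |y| ≤ 1) :
    |X (y, φ y) - X (x, φ x) - D (x, φ x) (1, ψ x) * (y - x)| ≤ 2 * e * |y - x| ^ 2 := by
  have h1 := hX.taylor _ _ (hφ.norm_le hx) (hφ.norm_le hy)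
  have h2 : ‖(y, φ y) - (x, φ x)‖ ^ 2 ≤ |y - x| ^ 2 :=
    pow_le_pow_left₀ (norm_nonneg _) (hφ.norm_sub_le hx hy) 2
  have h3 : D (x, φ x) ((y, φ y) - (x, φ x)) =
      D (x, φ x) (1, ψ x) * (y - x) + D (x, φ x) (0, φ y - φ x - ψ x * (y - x)) := by
    have : ((y, φ y) - (x, φ x) : ℝ × ℝ) =
        (y - x) • (1, ψ x) + (0, φ y - φ x - ψ x * (y - x)) := by
      ext <;> simp
      ring
    rw [this, map_add, map_smul, smul_eq_mul, mul_comm]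
  have h4 : |D (x, φ x) (0, φ y - φ x - ψ x * (y - x))| ≤ e * |y - x| ^ 2 := by
    calc _ ≤ ‖D (x, φ x)‖ * ‖((0 : ℝ), φ y - φ x - ψ x * (y - x))‖ := (D (x, φ x)).le_opNorm _
      _ ≤ e * |y - x| ^ 2 := by
        refine mul_le_mul (hX.fderiv_le _ (hφ.norm_le hx)) ?_ (norm_nonneg _) hX.nonneg
        rw [Prod.norm_def]
        exact max_le (by simpa using sq_nonneg (y - x)) (hφ.taylor x y hx hy)
  have h5 := mul_le_mul_of_nonneg_left h2 hX.nonneg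
  rw [h3] at h1
  calc _ = |(X (y, φ y) - X (x, φ x) - (D (x, φ x) (1, ψ x) * (y - x) +
        D (x, φ x) (0, φ y - φ x - ψ x * (y - x)))) +
        D (x, φ x) (0, φ y - φ x - ψ x * (y - x))| := by ring_nf
    _ ≤ _ := (abs_add_le _ _).trans (by linarith)

/-- The step moves a point by at most `1/4`, harmless when `|x| ≤ 3/4`. Beyond that `X` points
outward, so the backward step goes inward. -/
lemma IsC11Graph.abs_graphFoot_le {φ ψ : ℝ → ℝ} (hφ : IsC11Graph φ ψ) {X : ℝ × ℝ → ℝ}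
    {D : ℝ × ℝ → ℝ × ℝ →L[ℝ] ℝ} {e h : ℝ} (hX : IsSmallC11 X D e) (he : e ≤ 1 / 4)
    (hpos : ∀ x y, 3 / 4 ≤ x → x ≤ 1 → |y| ≤ 1 → 0 ≤ X (x, y))
    (hneg : ∀ x y, -1 ≤ x → x ≤ -3 / 4 → |y| ≤ 1 → X (x, y) ≤ 0)
    (h0 : 0 < h) (h1 : h ≤ 1) {x : ℝ} (hx : |x| ≤ 1) : |graphFoot X h φ x| ≤ 1 := by
  have hy := hφ.abs_apply_le hx
  have hb : |h * X (x, φ x)| ≤ 1 / 4 := by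
    rw [abs_mul, abs_of_pos h0]
    exact (mul_le_of_le_one_left (abs_nonneg _) h1).trans ((hX.abs_apply_le (hφ.norm_le hx)).trans he)
  rw [abs_le] at hx hb ⊢
  unfold graphFoot
  rcases le_total (3 / 4) x with h2 | h2
  · have := mul_nonneg h0.le (hpos x _ h2 hx.2 hy)
    constructor <;> linarith
  · rcases le_total x (-3 / 4) with h3 | h3
    · have := mul_nonneg h0.le (neg_nonneg.2 (hneg x _ hx.1 h3 hy))
      constructor <;> linarith
    · constructor <;> linarith

lemma IsC11Graph.abs_graphFoot_sub_le {φ ψ : ℝ → ℝ} (hφ : IsC11Graph φ ψ) {X : ℝ × ℝ → ℝ}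
    {D : ℝ × ℝ → ℝ × ℝ →L[ℝ] ℝ} {e h : ℝ} (hX : IsSmallC11 X D e) (h0 : 0 < h) {x y : ℝ}
    (hx : |x| ≤ 1) (hy : |y| ≤ 1) :
    |graphFoot X h φ y - graphFoot X h φ x| ≤ (1 + h * e) * |y - x| := by
  have h1 := mul_le_mul_of_nonneg_left (hφ.abs_comp_sub_le hX hx hy) h0.le
  calc _ = |(y - x) - h * (X (y, φ y) - X (x, φ x))| := by unfold graphFoot; ring_nf
    _ ≤ |y - x| + |h * (X (y, φ y) - X (x, φ x))| := abs_sub _ _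
    _ ≤ _ := by rw [abs_mul, abs_of_pos h0]; linarith

/-- Transport and forcing enlarge each bound by a factor `1 + O(h e)`, while the damping divides it
by `1 + lam h`. With `lam` dominating `e` the same constants survive, for every step size `h ≤ 1`.
The new slope is the formal chain rule. -/
lemma IsC11Graph.step {φ ψ : ℝ → ℝ} (hφ : IsC11Graph φ ψ) {X R : ℝ × ℝ → ℝ}
    {D E : ℝ × ℝ → ℝ × ℝ →L[ℝ] ℝ} {e h lam : ℝ} (hX : IsSmallC11 X D e) (hR : IsSmallC11 R E e)
    (he : e ≤ 1 / 4) (hlam : 7 * e ≤ lam)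
    (hpos : ∀ x y, 3 / 4 ≤ x → x ≤ 1 → |y| ≤ 1 → 0 ≤ X (x, y))
    (hneg : ∀ x y, -1 ≤ x → x ≤ -3 / 4 → |y| ≤ 1 → X (x, y) ≤ 0)
    (h0 : 0 < h) (h1 : h ≤ 1) :
    IsC11Graph (graphStep X R lam h φ) fun x =>
      (ψ (graphFoot X h φ x) * (1 - h * D (x, φ x) (1, ψ x)) + h * E (x, φ x) (1, ψ x)) /
        (1 + lam * h) := by
  have he0 := hX.nonneg
  have hden : 0 < 1 + lam * h := by nlinarith
  have hhe : 7 * (h * e) ≤ lam * h := by nlinarith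
  have hhe0 : 0 ≤ h * e := by positivity
  have hfoot : ∀ x, |x| ≤ 1 → |graphFoot X h φ x| ≤ 1 := fun x hx =>
    hφ.abs_graphFoot_le hX he hpos hneg h0 h1 hx
  have hslope : ∀ x, |x| ≤ 1 → |1 - h * D (x, φ x) (1, ψ x)| ≤ 1 + h * e := fun x hx => by
    refine (abs_sub _ _).trans ?_
    rw [abs_one, abs_mul, abs_of_pos h0]
    have := mul_le_mul_of_nonneg_left (hφ.abs_fderiv_le hX hx) h0.le
    linarith
  have hfoot0 : graphFoot X h φ 0 = 0 := by
    have : X (0, 0) = 0 := hX.zero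
    simp [graphFoot, hφ.zero, this]
  refine ⟨?_, ?_, fun x y hx hy => ?_, fun x hx => ?_, fun x y hx hy => ?_⟩
  · have : R (0, 0) = 0 := hR.zero
    simp [graphStep, hfoot0, hφ.zero, this]
  · have : E (0, 0) = 0 := hR.fderiv_zero
    simp [hfoot0, hφ.zero, hφ.deriv_zero, this]
  · rw [graphStep, graphStep, ← sub_div, abs_div, abs_of_pos hden,
      div_le_iff₀ hden]
    have h2 := (hφ.lipschitz _ _ (hfoot x hx) (hfoot y hy)).trans
      (hφ.abs_graphFoot_sub_le hX h0 hx hy)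
    have h3 := mul_le_mul_of_nonneg_left (hφ.abs_comp_sub_le hR hx hy) h0.le
    have h4 := mul_le_mul_of_nonneg_right hhe (abs_nonneg (y - x))
    have h5 := mul_nonneg hhe0 (abs_nonneg (y - x))
    calc _ = |(φ (graphFoot X h φ y) - φ (graphFoot X h φ x)) +
          h * (R (y, φ y) - R (x, φ x))| := by ring_nf
      _ ≤ |φ (graphFoot X h φ y) - φ (graphFoot X h φ x)| +
          |h * (R (y, φ y) - R (x, φ x))| := abs_add_le _ _
      _ ≤ _ := by rw [abs_mul, abs_of_pos h0]; linarith
  · rw [abs_div, abs_of_pos hden, div_le_one hden]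
    have h2 : |ψ (graphFoot X h φ x) * (1 - h * D (x, φ x) (1, ψ x))| ≤ 1 + h * e := by
      rw [abs_mul]
      exact (mul_le_of_le_one_left (abs_nonneg _) (hφ.deriv_le _ (hfoot x hx))).trans (hslope x hx)
    have h3 := mul_le_mul_of_nonneg_left (hφ.abs_fderiv_le hR hx) h0.le
    refine (abs_add_le _ _).trans ?_
    rw [abs_mul h, abs_of_pos h0]
    linarith
  · rw [graphStep, graphStep, ← sub_div, div_mul_eq_mul_div, ← sub_div,
      abs_div, abs_of_pos hden, div_le_iff₀ hden]
    have h2 : |φ (graphFoot X h φ y) - φ (graphFoot X h φ x) -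
        ψ (graphFoot X h φ x) * (graphFoot X h φ y - graphFoot X h φ x)| ≤
        (1 + h * e) ^ 2 * |y - x| ^ 2 := by
      refine (hφ.taylor _ _ (hfoot x hx) (hfoot y hy)).trans ?_
      rw [← mul_pow]
      exact pow_le_pow_left₀ (abs_nonneg _) (hφ.abs_graphFoot_sub_le hX h0 hx hy) 2
    have h3 : |ψ (graphFoot X h φ x) * (graphFoot X h φ y - graphFoot X h φ x -
        (1 - h * D (x, φ x) (1, ψ x)) * (y - x))| ≤ h * (2 * e * |y - x| ^ 2) := by
      rw [abs_mul]
      refine (mul_le_of_le_one_left (abs_nonneg _) (hφ.deriv_le _ (hfoot x hx))).trans ?_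
      have : graphFoot X h φ y - graphFoot X h φ x - (1 - h * D (x, φ x) (1, ψ x)) * (y - x) =
          -(h * (X (y, φ y) - X (x, φ x) - D (x, φ x) (1, ψ x) * (y - x))) := by
        unfold graphFoot; ring
      rw [this, abs_neg, abs_mul, abs_of_pos h0]
      exact mul_le_mul_of_nonneg_left (hφ.abs_comp_taylor_le hX hx hy) h0.le
    have h4 : |h * (R (y, φ y) - R (x, φ x) - E (x, φ x) (1, ψ x) * (y - x))| ≤
        h * (2 * e * |y - x| ^ 2) := by
      rw [abs_mul, abs_of_pos h0]
      exact mul_le_mul_of_nonneg_left (hφ.abs_comp_taylor_le hR hx hy) h0.le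
    -- The source of the constant `7`: the left side is `1 + 6he + (he)²`, and `(he)² ≤ he`.
    have h5 : (1 + h * e) ^ 2 + 4 * (h * e) ≤ 1 + lam * h := by
      have h6 : h * e ≤ 1 := by nlinarith
      nlinarith
    have h6 := mul_le_mul_of_nonneg_right h5 (sq_nonneg |y - x|)
    calc _ = |(φ (graphFoot X h φ y) - φ (graphFoot X h φ x) -
          ψ (graphFoot X h φ x) * (graphFoot X h φ y - graphFoot X h φ x)) +
          ψ (graphFoot X h φ x) * (graphFoot X h φ y - graphFoot X h φ x -
          (1 - h * D (x, φ x) (1, ψ x)) * (y - x)) +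
          h * (R (y, φ y) - R (x, φ x) - E (x, φ x) (1, ψ x) * (y - x))| := by ring_nf
      _ ≤ _ := (abs_add_three _ _ _).trans (by linarith)

/-- Before damping the distance grows at most to `(1 + 2he) d`: one `he` comes from the shift of the
feet, seen through a 1-Lipschitz graph, the other from `R`. Here `2he ≤ lam h / 2`. -/
lemma IsC11Graph.abs_step_sub_le {φ ψ φ' ψ' : ℝ → ℝ} (hφ : IsC11Graph φ ψ)
    (hφ' : IsC11Graph φ' ψ') {X R : ℝ × ℝ → ℝ}
    {D E : ℝ × ℝ → ℝ × ℝ →L[ℝ] ℝ} {e h lam d : ℝ} (hX : IsSmallC11 X D e)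
    (hR : IsSmallC11 R E e) (he : e ≤ 1 / 4) (hlam : 7 * e ≤ lam)
    (hpos : ∀ x y, 3 / 4 ≤ x → x ≤ 1 → |y| ≤ 1 → 0 ≤ X (x, y))
    (hneg : ∀ x y, -1 ≤ x → x ≤ -3 / 4 → |y| ≤ 1 → X (x, y) ≤ 0)
    (h0 : 0 < h) (h1 : h ≤ 1) (hd : ∀ x, |x| ≤ 1 → |φ x - φ' x| ≤ d) {x : ℝ} (hx : |x| ≤ 1) :
    |graphStep X R lam h φ x - graphStep X R lam h φ' x| ≤
      (1 + lam * h / 2) / (1 + lam * h) * d := by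
  have he0 := hX.nonneg
  have hden : 0 < 1 + lam * h := by nlinarith
  have hhe : 7 * (h * e) ≤ lam * h := by nlinarith
  have hfx : |graphFoot X h φ x| ≤ 1 := hφ.abs_graphFoot_le hX he hpos hneg h0 h1 hx
  have hfx' : |graphFoot X h φ' x| ≤ 1 := hφ'.abs_graphFoot_le hX he hpos hneg h0 h1 hx
  have hd0 : 0 ≤ d := (abs_nonneg _).trans (hd x hx)
  have hdist : ‖((x, φ x) - (x, φ' x) : ℝ × ℝ)‖ ≤ d := by
    rw [Prod.norm_def]
    exact max_le (by simpa using hd0) (hd x hx)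
  have h2 : |X (x, φ x) - X (x, φ' x)| ≤ e * d :=
    (hX.lipschitz _ _ (hφ'.norm_le hx) (hφ.norm_le hx)).trans
      (mul_le_mul_of_nonneg_left hdist he0)
  have h3 : |R (x, φ x) - R (x, φ' x)| ≤ e * d :=
    (hR.lipschitz _ _ (hφ'.norm_le hx) (hφ.norm_le hx)).trans
      (mul_le_mul_of_nonneg_left hdist he0)
  have h4 : |φ' (graphFoot X h φ x) - φ' (graphFoot X h φ' x)| ≤ h * (e * d) := by
    refine (hφ'.lipschitz _ _ hfx' hfx).trans ?_
    have : graphFoot X h φ x - graphFoot X h φ' x = -(h * (X (x, φ x) - X (x, φ' x))) := by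
      unfold graphFoot; ring
    rw [this, abs_neg, abs_mul, abs_of_pos h0]
    exact mul_le_mul_of_nonneg_left h2 h0.le
  have h5 : |h * (R (x, φ x) - R (x, φ' x))| ≤ h * (e * d) := by
    rw [abs_mul, abs_of_pos h0]
    exact mul_le_mul_of_nonneg_left h3 h0.le
  have h6 := mul_le_mul_of_nonneg_right hhe hd0
  have h7 : 0 ≤ h * e * d := by positivity
  rw [graphStep, graphStep, ← sub_div, abs_div, abs_of_pos hden,
    div_mul_eq_mul_div]
  refine div_le_div_of_nonneg_right ?_ hden.le
  calc _ = |(φ (graphFoot X h φ x) - φ' (graphFoot X h φ x)) +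
        (φ' (graphFoot X h φ x) - φ' (graphFoot X h φ' x)) +
        h * (R (x, φ x) - R (x, φ' x))| := by ring_nf
    _ ≤ d + h * (e * d) + h * (e * d) :=
      (abs_add_three _ _ _).trans (add_le_add (add_le_add (hd _ hfx) h4) h5)
    _ ≤ _ := by linarith

lemma isC11Graph_zero : IsC11Graph (fun _ => 0) fun _ => 0 where
  zero := rfl
  deriv_zero := rfl
  lipschitz x y _ _ := by simp
  deriv_le x _ := by simp
  taylor x y _ _ := by simpa using sq_nonneg (y - x)

/-- Iterating the graph transform gives approximate solutions of `X φ' = -lam φ + R`. -/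
lemma exists_approximate_graph {X R : ℝ × ℝ → ℝ} {D E : ℝ × ℝ → ℝ × ℝ →L[ℝ] ℝ} {e h lam : ℝ}
    (hX : IsSmallC11 X D e) (hR : IsSmallC11 R E e) (he : e ≤ 1 / 4) (hlam0 : 0 < lam)
    (hlam : 7 * e ≤ lam)
    (hpos : ∀ x y, 3 / 4 ≤ x → x ≤ 1 → |y| ≤ 1 → 0 ≤ X (x, y))
    (hneg : ∀ x y, -1 ≤ x → x ≤ -3 / 4 → |y| ≤ 1 → X (x, y) ≤ 0)
    (h0 : 0 < h) (h1 : h ≤ 1) :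
    ∃ φ ψ : ℝ → ℝ, IsC11Graph φ ψ ∧
      ∀ x, |x| ≤ 1 → |lam * φ x + X (x, φ x) * ψ x - R (x, φ x)| ≤ (lam + 2) * h := by
  set T := graphStep X R lam h with hT
  have hden : 0 < 1 + lam * h := by positivity
  have hiter : ∀ k : ℕ, ∃ ψ, IsC11Graph (T^[k] fun _ => 0) ψ := by
    intro k
    induction k with
    | zero => exact ⟨_, isC11Graph_zero⟩
    | succ k ih =>
      obtain ⟨ψ, hψ⟩ := ih
      rw [Function.iterate_succ_apply']
      exact ⟨_, hψ.step hX hR he hlam hpos hneg h0 h1⟩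
  set θ := (1 + lam * h / 2) / (1 + lam * h) with hθ
  have hθ0 : 0 ≤ θ := by positivity
  have hθ1 : θ < 1 := by
    rw [hθ, div_lt_one hden]
    nlinarith [mul_pos hlam0 h0]
  have hcontr : ∀ k : ℕ, ∀ x, |x| ≤ 1 →
      |(T^[k + 1] fun _ => 0) x - (T^[k] fun _ => 0) x| ≤ θ ^ k := by
    intro k
    induction k with
    | zero =>
      intro x hx
      obtain ⟨ψ, hψ⟩ := hiter 1
      simpa using hψ.abs_apply_le hx
    | succ k ih =>
      intro x hx
      obtain ⟨ψ, hψ⟩ := hiter (k + 1)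
      obtain ⟨ψ', hψ'⟩ := hiter k
      have := hψ.abs_step_sub_le hψ' hX hR he hlam hpos hneg h0 h1 ih hx
      rw [Function.iterate_succ_apply' T (k + 1), pow_succ']
      nth_rw 2 [Function.iterate_succ_apply' T k]
      exact this
  -- Iterates within `h²` of each other suffice: the residual is obtained after division by `h`,
  -- which leaves an error of order `h`. No exact fixed point is needed.
  obtain ⟨k, hk⟩ := exists_pow_lt_of_lt_one (pow_pos h0 2) hθ1
  obtain ⟨ψ, hψ⟩ := hiter k
  set φ := T^[k] fun _ => 0 with hφ
  refine ⟨φ, ψ, hψ, fun x hx => ?_⟩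
  have h2 : |T φ x - φ x| ≤ h ^ 2 := by
    have := (hcontr k x hx).trans hk.le
    rwa [Function.iterate_succ_apply'] at this
  have h3 : T φ x * (1 + lam * h) = φ (graphFoot X h φ x) + h * R (x, φ x) :=
    div_mul_cancel₀ _ hden.ne'
  have h4 := hψ.taylor x _ hx (hψ.abs_graphFoot_le hX he hpos hneg h0 h1 hx)
  have h5 : graphFoot X h φ x - x = -(h * X (x, φ x)) := by unfold graphFoot; ring
  have h6 : |h * X (x, φ x)| ≤ h := by
    rw [abs_mul, abs_of_pos h0]
    exact mul_le_of_le_one_right h0.le ((hX.abs_apply_le (hψ.norm_le hx)).trans (by linarith))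
  rw [h5, abs_neg] at h4
  have h7 := h4.trans (pow_le_pow_left₀ (abs_nonneg _) h6 2)
  -- The residual splits into the Taylor remainder of `φ` between `x` and its foot and the defect `T
  -- φ - φ`; both are of order `h²`.
  have h8 : h * (lam * φ x + X (x, φ x) * ψ x - R (x, φ x)) =
      (φ (graphFoot X h φ x) - φ x - ψ x * -(h * X (x, φ x))) -
        (1 + lam * h) * (T φ x - φ x) := by
    linear_combination h3
  have h9 : h * |lam * φ x + X (x, φ x) * ψ x - R (x, φ x)| ≤ h * ((lam + 2) * h) := by
    rw [← abs_of_pos h0, ← abs_mul, abs_of_pos h0, h8]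
    refine (abs_sub _ _).trans ?_
    rw [abs_mul, abs_of_pos hden]
    have := mul_le_mul_of_nonneg_left h2 hden.le
    nlinarith [mul_nonneg hlam0.le (sq_nonneg h)]
  exact le_of_mul_le_mul_left h9 h0

/-- Bounded real sequences have limits along an ultrafilter. -/
lemma exists_tendsto_ultrafilter {ι : Type*} (U : Ultrafilter ι) {u : ι → ℝ} (hu : ∀ i, |u i| ≤ 1) :
    ∃ a, Tendsto u U (𝓝 a) := by
  have hK : IsCompact (Icc (-1 : ℝ) 1) := isCompact_Icc
  obtain ⟨a, -, ha⟩ := hK.ultrafilter_le_nhds (U.map u)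
    (le_principal_iff.2 (Eventually.of_forall (f := (U : Filter ι)) fun i => abs_le.1 (hu i)))
  exact ⟨a, ha⟩

/-- Approximate graphs with step `1 / (n + 1)` obey uniform bounds, so a nonprincipal ultrafilter
yields limits of values and slopes at all points at once. The `C^{1,1}` class is given by pointwise
closed inequalities and hence survives, while the residual tends to `0`. -/
lemma exists_invariant_graph {X R : ℝ × ℝ → ℝ} {D E : ℝ × ℝ → ℝ × ℝ →L[ℝ] ℝ} {e lam : ℝ}
    (hX : IsSmallC11 X D e) (hR : IsSmallC11 R E e) (he : e ≤ 1 / 4) (hlam0 : 0 < lam)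
    (hlam : 7 * e ≤ lam)
    (hpos : ∀ x y, 3 / 4 ≤ x → x ≤ 1 → |y| ≤ 1 → 0 ≤ X (x, y))
    (hneg : ∀ x y, -1 ≤ x → x ≤ -3 / 4 → |y| ≤ 1 → X (x, y) ≤ 0) :
    ∃ φ ψ : ℝ → ℝ, IsC11Graph φ ψ ∧
      ∀ x, |x| ≤ 1 → X (x, φ x) * ψ x = -lam * φ x + R (x, φ x) := by
  have hstep : ∀ n : ℕ, (0 : ℝ) < 1 / (n + 1) ∧ (1 : ℝ) / (n + 1) ≤ 1 := fun n =>
    ⟨Nat.one_div_pos_of_nat, by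
      rw [div_le_one (Nat.cast_add_one_pos n)]
      linarith [Nat.cast_nonneg (α := ℝ) n]⟩
  choose u v huv heq using fun n : ℕ => exists_approximate_graph hX hR he hlam0 hlam hpos hneg
    (hstep n).1 (hstep n).2
  set U : Ultrafilter ℕ := hyperfilter ℕ
  have hlimu : ∀ x, ∃ a, |x| ≤ 1 → Tendsto (fun n => u n x) U (𝓝 a) := fun x => by
    by_cases hx : |x| ≤ 1
    · obtain ⟨a, ha⟩ := exists_tendsto_ultrafilter U fun n => (huv n).abs_apply_le hx
      exact ⟨a, fun _ => ha⟩
    · exact ⟨0, fun h => absurd h hx⟩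
  have hlimv : ∀ x, ∃ a, |x| ≤ 1 → Tendsto (fun n => v n x) U (𝓝 a) := fun x => by
    by_cases hx : |x| ≤ 1
    · obtain ⟨a, ha⟩ := exists_tendsto_ultrafilter U fun n => (huv n).deriv_le x hx
      exact ⟨a, fun _ => ha⟩
    · exact ⟨0, fun h => absurd h hx⟩
  choose φ hφ using hlimu
  choose ψ hψ using hlimv
  have h00 : |(0 : ℝ)| ≤ 1 := by simp
  have hgraph : IsC11Graph φ ψ := by
    refine ⟨tendsto_nhds_unique (hφ 0 h00) ?_, tendsto_nhds_unique (hψ 0 h00) ?_,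
      fun x y hx hy => ?_, fun x hx => ?_, fun x y hx hy => ?_⟩
    · simp only [(huv _).zero, tendsto_const_nhds]
    · simp only [(huv _).deriv_zero, tendsto_const_nhds]
    · exact le_of_tendsto' ((hφ y hy).sub (hφ x hx)).abs fun n => (huv n).lipschitz x y hx hy
    · exact le_of_tendsto' (hψ x hx).abs fun n => (huv n).deriv_le x hx
    · exact le_of_tendsto' (((hφ y hy).sub (hφ x hx)).sub ((hψ x hx).mul_const (y - x))).abs
        fun n => (huv n).taylor x y hx hy
  refine ⟨φ, ψ, hgraph, fun x hx => ?_⟩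
  have hcont : ∀ {Y : ℝ × ℝ → ℝ} {G : ℝ × ℝ → ℝ × ℝ →L[ℝ] ℝ}, IsSmallC11 Y G e →
      Tendsto (fun n => Y (x, u n x)) U (𝓝 (Y (x, φ x))) := fun {Y G} hY => by
    rw [tendsto_iff_norm_sub_tendsto_zero]
    have h1 : Tendsto (fun n => e * |u n x - φ x|) U (𝓝 0) := by
      simpa using ((hφ x hx).sub_const (φ x)).abs.const_mul e
    refine squeeze_zero (fun _ => norm_nonneg _) (fun n => ?_) h1
    refine (hY.lipschitz _ _ (hgraph.norm_le hx) ((huv n).norm_le hx)).trans ?_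
    refine mul_le_mul_of_nonneg_left ?_ hY.nonneg
    rw [Prod.norm_def]
    exact max_le (by simp) le_rfl
  have hU : (U : Filter ℕ) ≤ atTop := Nat.hyperfilter_le_atTop
  have h1 : Tendsto (fun n : ℕ => (lam + 2) * ((1 : ℝ) / (n + 1))) U (𝓝 0) := by
    simpa using (tendsto_one_div_add_atTop_nhds_zero_nat.mono_left hU).const_mul (lam + 2)
  have h2 := ((((hφ x hx).const_mul lam).add ((hcont hX).mul (hψ x hx))).sub (hcont hR)).abs
  have h3 := le_of_tendsto_of_tendsto' h2 h1 fun n => heq n x hx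
  linarith [abs_nonpos_iff.1 h3]

lemma IsC11Graph.hasDerivAt {φ ψ : ℝ → ℝ} (hφ : IsC11Graph φ ψ) {x : ℝ} (hx : |x| < 1) :
    HasDerivAt φ (ψ x) x := by
  rw [hasDerivAt_iff_isLittleO]
  have hO : (fun y => φ y - φ x - (y - x) • ψ x) =O[𝓝 x] fun y => ‖y - x‖ ^ 2 := by
    refine Asymptotics.IsBigO.of_bound 1 ?_
    filter_upwards [(continuous_abs.tendsto x).eventually_lt_const hx] with y hy
    rw [smul_eq_mul, mul_comm, norm_pow, norm_norm, one_mul]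
    exact hφ.taylor x y hx.le hy.le
  exact hO.trans_isLittleO (Asymptotics.isLittleO_pow_sub_sub x one_lt_two)

/-- Adding the Taylor bounds based at `x` and at `y` shows that `ψ` is 2-Lipschitz. -/
lemma IsC11Graph.continuousOn {φ ψ : ℝ → ℝ} (hφ : IsC11Graph φ ψ) :
    ContinuousOn ψ (Ioo (-1) 1) := by
  have : LipschitzOnWith 2 ψ (Ioo (-1) 1) := by
    refine LipschitzOnWith.of_dist_le_mul fun y hy x hx => ?_
    rw [Real.dist_eq, Real.dist_eq, NNReal.coe_ofNat]
    rcases eq_or_ne y x with rfl | hne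
    · simp
    · have hpos : 0 < |y - x| := abs_pos.2 (sub_ne_zero.2 hne)
      have hx' := abs_le.2 ⟨hx.1.le, hx.2.le⟩
      have hy' := abs_le.2 ⟨hy.1.le, hy.2.le⟩
      have h1 := hφ.taylor x y hx' hy'
      have h2 := hφ.taylor y x hy' hx'
      rw [abs_sub_comm x y] at h2
      refine le_of_mul_le_mul_right ?_ hpos
      rw [← abs_mul]
      calc |(ψ y - ψ x) * (y - x)| = |(φ y - φ x - ψ x * (y - x)) +
            (φ x - φ y - ψ y * (x - y))| := by ring_nf
        _ ≤ _ := (abs_add_le _ _).trans (by linarith)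
  exact this.continuousOn

/-! ### Localization: rescaling and an outward pointing correction -/

/-- The differential is `K`-Lipschitz near `0` and vanishes there. After zooming by `r` its size,
and the Taylor constant, are at most `K r`. -/
lemma isSmallC11_rescale {X : ℝ × ℝ → ℝ} (hX : ContDiffAt ℝ 2 X 0) (h0 : X 0 = 0)
    (h0' : fderiv ℝ X 0 = 0) {e : ℝ} (he : 0 < e) :
    ∃ r₀ > 0, ∀ r, 0 < r → r ≤ r₀ →
      IsSmallC11 (fun p => X (r • p) / r) (fun p => fderiv ℝ X (r • p)) e := by
  obtain ⟨K, t, ht, hK⟩ := (hX.fderiv_right (m := 1) (by norm_num)).exists_lipschitzOnWith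
  have hdiff : ∀ᶠ p in 𝓝 (0 : ℝ × ℝ), DifferentiableAt ℝ X p := by
    filter_upwards [hX.eventually (by simp)] with p hp
    exact hp.differentiableAt two_ne_zero
  obtain ⟨ρ, hρ, hball⟩ := Metric.eventually_nhds_iff.1 (hdiff.and ht)
  have hsmall : ∀ p : ℝ × ℝ, ‖p‖ < ρ → DifferentiableAt ℝ X p ∧ p ∈ t := fun p hp =>
    hball (by rwa [dist_zero_right])
  refine ⟨min (ρ / 2) (e / (K + 1)), lt_min (half_pos hρ) (by positivity), fun r hr hrr => ?_⟩
  have hrρ : r < ρ := by linarith [hrr.trans (min_le_left _ _)]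
  have hrK : K * r ≤ e := by
    have h1 := (le_div_iff₀ (by positivity)).1 (hrr.trans (min_le_right _ _))
    linarith
  have hnorm : ∀ p : ℝ × ℝ, ‖r • p‖ = r * ‖p‖ := fun p => by
    rw [norm_smul, Real.norm_of_nonneg hr.le]
  have hle : ∀ p : ℝ × ℝ, ‖p‖ ≤ 1 → ‖r • p‖ ≤ r := fun p hp => by
    rw [hnorm]
    exact mul_le_of_le_one_right hr.le hp
  have hd : ∀ p q : ℝ × ℝ, ‖p‖ ≤ r → ‖q‖ ≤ r →
      ‖fderiv ℝ X q - fderiv ℝ X p‖ ≤ K * ‖q - p‖ := fun p q hp hq => by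
    simpa [dist_eq_norm] using
      hK.dist_le_mul _ (hsmall q (hq.trans_lt hrρ)).2 _ (hsmall p (hp.trans_lt hrρ)).2
  have hd0 : ∀ p : ℝ × ℝ, ‖p‖ ≤ r → ‖fderiv ℝ X p‖ ≤ e := fun p hp => by
    have h1 := hd 0 p (by simpa using hr.le) hp
    rw [h0', sub_zero, sub_zero] at h1
    exact h1.trans ((mul_le_mul_of_nonneg_left hp K.coe_nonneg).trans hrK)
  have hsub : ∀ p q : ℝ × ℝ, ‖r • q - r • p‖ = r * ‖q - p‖ := fun p q => by
    rw [← smul_sub, hnorm]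
  have hdiff' : ∀ z ∈ Metric.closedBall (0 : ℝ × ℝ) r, DifferentiableAt ℝ X z := fun z hz =>
    (hsmall z ((mem_closedBall_zero_iff.1 hz).trans_lt hrρ)).1
  have hmem : ∀ p : ℝ × ℝ, ‖p‖ ≤ 1 → r • p ∈ Metric.closedBall (0 : ℝ × ℝ) r := fun p hp =>
    mem_closedBall_zero_iff.2 (hle p hp)
  refine ⟨by simp [h0], by simp [h0'], fun p q hp hq => ?_, fun p hp => hd0 _ (hle p hp),
    fun p q hp hq => ?_⟩
  · have h1 := (convex_closedBall (0 : ℝ × ℝ) r).norm_image_sub_le_of_norm_fderiv_le hdiff'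
      (fun z hz => hd0 z (mem_closedBall_zero_iff.1 hz)) (hmem p hp) (hmem q hq)
    rw [hsub, Real.norm_eq_abs] at h1
    rw [← sub_div, abs_div, abs_of_pos hr, div_le_iff₀ hr]
    linarith
  · have hseg : segment ℝ (r • p) (r • q) ⊆ Metric.closedBall (0 : ℝ × ℝ) r :=
      (convex_closedBall (0 : ℝ × ℝ) r).segment_subset (hmem p hp) (hmem q hq)
    have h1 := (convex_segment (r • p) (r • q)).norm_image_sub_le_of_norm_fderiv_le'
      (φ := fderiv ℝ X (r • p)) (C := K * (r * ‖q - p‖)) (fun z hz => hdiff' z (hseg hz))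
      (fun z hz => (hd _ z (hle p hp) (mem_closedBall_zero_iff.1 (hseg hz))).trans (by
        rw [← hsub]
        exact mul_le_mul_of_nonneg_left (norm_sub_le_of_mem_segment hz) K.coe_nonneg))
      (left_mem_segment ℝ _ _) (right_mem_segment ℝ _ _)
    rw [hsub, Real.norm_eq_abs, ← smul_sub, map_smul, smul_eq_mul] at h1
    have h2 : X (r • q) / r - X (r • p) / r - fderiv ℝ X (r • p) (q - p) =
        (X (r • q) - X (r • p) - r * fderiv ℝ X (r • p) (q - p)) / r := by
      field_simp
    rw [h2, abs_div, abs_of_pos hr, div_le_iff₀ hr]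
    have h3 := mul_le_mul_of_nonneg_right hrK (mul_nonneg (sq_nonneg ‖q - p‖) hr.le)
    linarith

lemma abs_sq_max_sub_le {a b : ℝ} (ha : a ≤ 1 / 2) (hb : b ≤ 1 / 2) :
    |max b 0 ^ 2 - max a 0 ^ 2| ≤ |b - a| := by
  have h1 : |max b 0 - max a 0| ≤ |b - a| := abs_max_sub_max_le_abs b a 0
  have h2 : |max b 0 + max a 0| ≤ 1 := by
    rw [abs_of_nonneg (add_nonneg (le_max_right _ _) (le_max_right _ _))]
    linarith [max_le hb (by norm_num : (0 : ℝ) ≤ 1 / 2), max_le ha (by norm_num : (0 : ℝ) ≤ 1 / 2)]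
  calc |max b 0 ^ 2 - max a 0 ^ 2| = |max b 0 - max a 0| * |max b 0 + max a 0| := by
        rw [← abs_mul]; ring_nf
    _ ≤ |b - a| * 1 := mul_le_mul h1 h2 (abs_nonneg _) (abs_nonneg _)
    _ = |b - a| := mul_one _

/-- The squared positive part has the 2-Lipschitz derivative `2 max(a, 0)`. It is not `C²`, but it
fits the `C^{1,1}` class. -/
lemma abs_sq_max_taylor_le (a b : ℝ) :
    |max b 0 ^ 2 - max a 0 ^ 2 - 2 * max a 0 * (b - a)| ≤ (b - a) ^ 2 := by
  rw [abs_le]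
  rcases le_total a 0 with ha | ha <;> rcases le_total b 0 with hb | hb <;>
    simp only [max_eq_left, max_eq_right, ha, hb]
  · constructor <;> nlinarith [sq_nonneg (b - a)]
  · constructor <;> nlinarith [mul_nonneg (neg_nonneg.2 ha) hb]
  · constructor <;> nlinarith [mul_nonneg ha (neg_nonneg.2 hb)]
  · constructor <;> nlinarith [sq_nonneg (b - a)]

/-- A `C^{1,1}` function vanishing on `[-1/2, 1/2]` that has the sign of its argument. -/
def outward (κ : ℝ) (p : ℝ × ℝ) : ℝ :=
  κ * (max (p.1 - 1 / 2) 0 ^ 2 - max (-p.1 - 1 / 2) 0 ^ 2)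

lemma isSmallC11_outward {κ : ℝ} (hκ : 0 ≤ κ) :
    IsSmallC11 (outward κ) (fun p => (κ * (2 * max (p.1 - 1 / 2) 0 + 2 * max (-p.1 - 1 / 2) 0)) •
      ContinuousLinearMap.fst ℝ ℝ ℝ) (2 * κ) := by
  have hfst : ∀ p : ℝ × ℝ, ‖p‖ ≤ 1 → -1 ≤ p.1 ∧ p.1 ≤ 1 := fun p hp =>
    abs_le.1 ((norm_fst_le p).trans hp)
  refine ⟨by norm_num [outward], by norm_num, fun p q hp hq => ?_, fun p hp => ?_,
    fun p q hp hq => ?_⟩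
  · obtain ⟨hp1, hp2⟩ := hfst p hp
    obtain ⟨hq1, hq2⟩ := hfst q hq
    have h1 := abs_sq_max_sub_le (a := p.1 - 1 / 2) (b := q.1 - 1 / 2) (by linarith) (by linarith)
    have h2 := abs_sq_max_sub_le (a := -p.1 - 1 / 2) (b := -q.1 - 1 / 2) (by linarith)
      (by linarith)
    rw [show q.1 - 1 / 2 - (p.1 - 1 / 2) = q.1 - p.1 by ring] at h1
    rw [show -q.1 - 1 / 2 - (-p.1 - 1 / 2) = -(q.1 - p.1) by ring, abs_neg] at h2
    have h3 : |q.1 - p.1| ≤ ‖q - p‖ := norm_fst_le (q - p)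
    calc |outward κ q - outward κ p| = κ * |(max (q.1 - 1 / 2) 0 ^ 2 - max (p.1 - 1 / 2) 0 ^ 2) -
          (max (-q.1 - 1 / 2) 0 ^ 2 - max (-p.1 - 1 / 2) 0 ^ 2)| := by
          rw [← abs_of_nonneg hκ, ← abs_mul, abs_of_nonneg hκ]; unfold outward; ring_nf
      _ ≤ κ * (2 * ‖q - p‖) :=
          mul_le_mul_of_nonneg_left ((abs_sub _ _).trans (by linarith)) hκ
      _ = 2 * κ * ‖q - p‖ := by ring
  · obtain ⟨hp1, hp2⟩ := hfst p hp
    have h1 : max (p.1 - 1 / 2) 0 ≤ 1 / 2 := max_le (by linarith) (by norm_num)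
    have h2 : max (-p.1 - 1 / 2) 0 ≤ 1 / 2 := max_le (by linarith) (by norm_num)
    have h3 := le_max_right (p.1 - 1 / 2) 0
    have h4 := le_max_right (-p.1 - 1 / 2) 0
    rw [norm_smul, Real.norm_of_nonneg (by positivity)]
    calc _ ≤ κ * 2 * 1 := mul_le_mul (mul_le_mul_of_nonneg_left (by linarith) hκ)
            (ContinuousLinearMap.norm_fst_le ℝ ℝ ℝ) (norm_nonneg _) (by positivity)
      _ = 2 * κ := by ring
  · have h1 := abs_sq_max_taylor_le (p.1 - 1 / 2) (q.1 - 1 / 2)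
    have h2 := abs_sq_max_taylor_le (-p.1 - 1 / 2) (-q.1 - 1 / 2)
    have h3 : (q.1 - p.1) ^ 2 ≤ ‖q - p‖ ^ 2 := by
      rw [← sq_abs]
      exact pow_le_pow_left₀ (abs_nonneg _) (norm_fst_le (q - p)) 2
    rw [show q.1 - 1 / 2 - (p.1 - 1 / 2) = q.1 - p.1 by ring] at h1
    rw [show -q.1 - 1 / 2 - (-p.1 - 1 / 2) = -(q.1 - p.1) by ring, neg_sq] at h2
    set A := max (q.1 - 1 / 2) 0 ^ 2 - max (p.1 - 1 / 2) 0 ^ 2 -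
      2 * max (p.1 - 1 / 2) 0 * (q.1 - p.1) with hA
    set B := max (-q.1 - 1 / 2) 0 ^ 2 - max (-p.1 - 1 / 2) 0 ^ 2 -
      2 * max (-p.1 - 1 / 2) 0 * -(q.1 - p.1) with hB
    have h4 : outward κ q - outward κ p -
        ((κ * (2 * max (p.1 - 1 / 2) 0 + 2 * max (-p.1 - 1 / 2) 0)) •
          ContinuousLinearMap.fst ℝ ℝ ℝ) (q - p) = κ * (A - B) := by
      simp only [smul_apply, ContinuousLinearMap.coe_fst', Prod.fst_sub, smul_eq_mul, outward]
      rw [hA, hB]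
      ring
    rw [h4, abs_mul, abs_of_nonneg hκ]
    calc κ * |A - B| ≤ κ * (2 * ‖q - p‖ ^ 2) :=
          mul_le_mul_of_nonneg_left ((abs_sub _ _).trans (by linarith)) hκ
      _ = 2 * κ * ‖q - p‖ ^ 2 := by ring

/-- A planar system `x' = X(x, y)`, `y' = -lam y + R(x, y)` with `X`, `R` of second order has a
`C¹` invariant graph through the origin, tangent to the `x`-axis. -/
lemma exists_center_graph {X R : ℝ × ℝ → ℝ} (hX : ContDiffAt ℝ 2 X 0) (hX0 : X 0 = 0)
    (hX1 : fderiv ℝ X 0 = 0) (hR : ContDiffAt ℝ 2 R 0) (hR0 : R 0 = 0) (hR1 : fderiv ℝ R 0 = 0)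
    {lam : ℝ} (hlam : 0 < lam) :
    ∃ η > 0, ∃ φ ψ : ℝ → ℝ, φ 0 = 0 ∧ ψ 0 = 0 ∧ (∀ x ∈ Ioo (-η) η, HasDerivAt φ (ψ x) x) ∧
      ContinuousOn ψ (Ioo (-η) η) ∧
      ∀ x ∈ Ioo (-η) η, X (x, φ x) * ψ x = -lam * φ x + R (x, φ x) := by
  -- The corrected field has bound `e + 2 * 16e = 33e`, which must not exceed `1/4` or `lam/7`. The
  -- strength `16e` is chosen because the squared positive part is at least `1/16` for `|x| ≥ 3/4`,
  -- so the correction outweighs `|X| ≤ e`.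
  set e : ℝ := min (1 / 4) (lam / 7) / 33 with he
  have hmin : 0 < min (1 / 4) (lam / 7) := lt_min (by norm_num) (by positivity)
  have he0 : 0 < e := by positivity
  have he33 : e + 2 * (16 * e) = min (1 / 4) (lam / 7) := by rw [he]; ring
  obtain ⟨r₁, hr₁, h1⟩ := isSmallC11_rescale hX hX0 hX1 he0
  obtain ⟨r₂, hr₂, h2⟩ := isSmallC11_rescale hR hR0 hR1 he0
  set r := min r₁ r₂ with hr
  have hr0 : 0 < r := lt_min hr₁ hr₂
  have hXr := h1 r hr0 (min_le_left _ _)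
  have hRr := h2 r hr0 (min_le_right _ _)
  have hY := hXr.add (isSmallC11_outward (by positivity : 0 ≤ 16 * e))
  have hRe := hRr.mono (by linarith : e ≤ e + 2 * (16 * e))
  have hnorm : ∀ x y : ℝ, |x| ≤ 1 → |y| ≤ 1 → ‖(x, y)‖ ≤ 1 := fun x y hx hy => by
    rw [Prod.norm_def]
    exact max_le hx hy
  obtain ⟨φ, ψ, hφ, heq⟩ := exists_invariant_graph hY hRe (he33.trans_le (min_le_left _ _)) hlam
    (by linarith [he33.trans_le (min_le_right _ _)])
    (fun x y hx hx1 hy => by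
      have h3 := neg_le_of_abs_le (hXr.abs_apply_le
        (hnorm x y (abs_le.2 ⟨by linarith, hx1⟩) hy))
      have h4 : max (x - 1 / 2) 0 = x - 1 / 2 := max_eq_left (by linarith)
      have h5 : max (-x - 1 / 2) 0 = 0 := max_eq_right (by linarith)
      simp only [outward, h4, h5]
      have h6 : 1 / 16 ≤ (x - 1 / 2) ^ 2 := by nlinarith
      nlinarith)
    (fun x y hx1 hx hy => by
      have h3 := le_of_abs_le (hXr.abs_apply_le
        (hnorm x y (abs_le.2 ⟨hx1, by linarith⟩) hy))
      have h4 : max (x - 1 / 2) 0 = 0 := max_eq_right (by linarith)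
      have h5 : max (-x - 1 / 2) 0 = -x - 1 / 2 := max_eq_left (by linarith)
      simp only [outward, h4, h5]
      have h6 : 1 / 16 ≤ (-x - 1 / 2) ^ 2 := by nlinarith
      nlinarith)
  -- On this range the outward correction vanishes, so the graph is invariant for the original
  -- system.
  have hdiv : ∀ x ∈ Ioo (-(r / 2)) (r / 2), -(1 / 2) < x / r ∧ x / r < 1 / 2 := fun x hx => by
    rw [lt_div_iff₀ hr0, div_lt_iff₀ hr0]
    constructor <;> linarith [hx.1, hx.2]
  refine ⟨r / 2, half_pos hr0, fun x => r * φ (x / r), fun x => ψ (x / r), by simp [hφ.zero],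
    by simp [hφ.deriv_zero], fun x hx => ?_, ?_, fun x hx => ?_⟩
  · obtain ⟨h3, h4⟩ := hdiv x hx
    have h5 := hφ.hasDerivAt (x := x / r) (abs_lt.2 ⟨by linarith, by linarith⟩)
    have h6 := (h5.comp x ((hasDerivAt_id x).div_const r)).const_mul r
    rw [mul_left_comm, mul_one_div_cancel hr0.ne', mul_one] at h6
    exact h6
  · refine hφ.continuousOn.comp (by fun_prop) fun x hx => ?_
    obtain ⟨h3, h4⟩ := hdiv x hx
    exact ⟨by linarith, by linarith⟩
  · obtain ⟨h3, h4⟩ := hdiv x hx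
    have h5 := heq (x / r) (abs_le.2 ⟨by linarith, by linarith⟩)
    have h6 : max (x / r - 1 / 2) 0 = 0 := max_eq_right (by linarith)
    have h7 : max (-(x / r) - 1 / 2) 0 = 0 := max_eq_right (by linarith)
    have h8 : r • (x / r, φ (x / r)) = (x, r * φ (x / r)) := by
      ext <;> simp
      field_simp
    simp only [outward, h6, h7, h8] at h5
    field_simp at h5
    linear_combination h5

/-! ### Center manifolds of the platform model -/

lemma contDiffAt_field {ε δ : ℝ} {V W : ℝ → ℝ} {p : ℝ × ℝ} {n : WithTop ℕ∞}
    (hV : ContDiffAt ℝ n V p.2) (hW : ContDiffAt ℝ n W p.1) :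
    ContDiffAt ℝ n (field ε δ V W) p := by
  have h1 : ContDiffAt ℝ n (fun q : ℝ × ℝ => V q.2) p := hV.comp p contDiffAt_snd
  have h2 : ContDiffAt ℝ n (fun q : ℝ × ℝ => W q.1) p := hW.comp p contDiffAt_fst
  exact (h1.sub (contDiffAt_const.mul contDiffAt_fst)).prodMk
    (h2.sub (contDiffAt_const.mul contDiffAt_snd))

lemma exists_isLocalCenterManifold {ε δ : ℝ} {V W : ℝ → ℝ} {p : ℝ × ℝ} (hε : 0 < ε) (hδ : 0 < δ)
    (hV : ContDiffAt ℝ 2 V p.2) (hW : ContDiffAt ℝ 2 W p.1) (hp : field ε δ V W p = 0)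
    (h : deriv V p.2 * deriv W p.1 = ε * δ) :
    ∃ η γ, IsLocalCenterManifold (field ε δ V W) p η γ := by
  have hVd := hV.differentiableAt two_ne_zero
  have hWd := hW.differentiableAt two_ne_zero
  have hF := hasFDerivAt_field (ε := ε) (δ := δ) hVd hWd
  have hFC : ContDiffAt ℝ 2 (field ε δ V W) p := contDiffAt_field hV hW
  have hspan := centerSubspace_field_eq_span hε hδ hVd hWd h
  set F := field ε δ V W with hFdef
  set v := deriv V p.2 with hv
  set w := deriv W p.1 with hw
  have hw0 : w ≠ 0 := fun h1 => by rw [h1, mul_zero] at h; exact (mul_pos hε hδ).ne h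
  have hlam : 0 < ε + δ := by positivity
  -- `A` is the inverse of the coordinates `(l, m)` below, which are left eigenvectors of the
  -- Jacobian: `l = (w, ε)` for the eigenvalue `0` and `m = (w, -δ)` for `-(ε + δ)`.
  set A : ℝ × ℝ →L[ℝ] ℝ × ℝ := ((δ / (w * (ε + δ))) • ContinuousLinearMap.fst ℝ ℝ ℝ +
    (ε / (w * (ε + δ))) • ContinuousLinearMap.snd ℝ ℝ ℝ).prod
    ((1 / (ε + δ)) • (ContinuousLinearMap.fst ℝ ℝ ℝ - ContinuousLinearMap.snd ℝ ℝ ℝ)) with hA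
  set l : ℝ × ℝ →L[ℝ] ℝ := w • ContinuousLinearMap.fst ℝ ℝ ℝ + ε • ContinuousLinearMap.snd ℝ ℝ ℝ
    with hl
  set m : ℝ × ℝ →L[ℝ] ℝ := w • ContinuousLinearMap.fst ℝ ℝ ℝ - δ • ContinuousLinearMap.snd ℝ ℝ ℝ
    with hm
  have hAlm : ∀ q, A (l q, m q) = q := fun q => by
    ext
    · simp [hA, hl, hm]
      field_simp
      ring
    · simp [hA, hl, hm]
      field_simp
  have hlA : ∀ q, l (A q) = q.1 := fun q => by
    simp [hA, hl]; field_simp; ring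
  have hmA : ∀ q, m (A q) = q.2 := fun q => by
    simp [hA, hm]; field_simp; ring
  have hbase : p + A 0 = p := by simp
  have hshift : HasFDerivAt (fun q => p + A q) A 0 := A.hasFDerivAt.const_add p
  have hFA := HasFDerivAt.comp (g := F) (0 : ℝ × ℝ) (by rw [hbase]; exact hF) hshift
  have hFAC : ContDiffAt ℝ 2 (fun q => F (p + A q)) 0 :=
    ContDiffAt.comp (g := F) (0 : ℝ × ℝ) (by rw [hbase]; exact hFC)
      (contDiffAt_const.add A.contDiff.contDiffAt)
  have hX := l.hasFDerivAt.comp (0 : ℝ × ℝ) hFA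
  have hR := (m.hasFDerivAt.comp (0 : ℝ × ℝ) hFA).add
    ((hasFDerivAt_snd (𝕜 := ℝ) (E := ℝ) (F := ℝ) (p := (0 : ℝ × ℝ))).const_mul (ε + δ))
  obtain ⟨η, hη, φ, ψ, hφ0, hψ0, hφ, hψ, heq⟩ := exists_center_graph
    (X := fun q => l (F (p + A q))) (R := fun q => m (F (p + A q)) + (ε + δ) * q.2)
    (l.contDiff.contDiffAt.comp (0 : ℝ × ℝ) hFAC) (by simp [hp])
    (by
      refine hX.fderiv.trans ?_
      ext <;> simp [hl, hm, hA]
      · field_simp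
        linear_combination h
      · field_simp
        linear_combination -h)
    ((m.contDiff.contDiffAt.comp (0 : ℝ × ℝ) hFAC).add (contDiffAt_const.mul contDiffAt_snd))
    (by simp [hp])
    (by
      refine hR.fderiv.trans ?_
      ext <;> simp [hm, hA]
      · field_simp
        linear_combination h
      · field_simp
        linear_combination -h)
    hlam
  have hγ : ∀ s ∈ Ioo (-η) η, HasDerivAt (fun s => p + A (s, φ s)) (A (1, ψ s)) s := fun s hs =>
    (A.hasFDerivAt.comp_hasDerivAt s ((hasDerivAt_id s).prodMk (hφ s hs))).const_add p
  have hlne : ∀ s, A (1, ψ s) ≠ 0 := fun s h1 => by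
    have := hlA (1, ψ s)
    rw [h1, map_zero] at this
    exact zero_ne_one this
  have h0 : (0 : ℝ) ∈ Ioo (-η) η := ⟨neg_lt_zero.2 hη, hη⟩
  refine ⟨η, fun s => p + A (s, φ s), hη, ?_, ?_, ?_, ?_, ?_, ?_⟩
  · rw [show (1 : WithTop ℕ∞) = 0 + 1 from rfl, contDiffOn_succ_iff_deriv_of_isOpen isOpen_Ioo]
    refine ⟨fun s hs => (hγ s hs).differentiableAt.differentiableWithinAt, by simp, ?_⟩
    rw [contDiffOn_zero]
    refine ContinuousOn.congr ?_ fun s hs => (hγ s hs).deriv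
    exact A.continuous.comp_continuousOn (continuousOn_const.prodMk hψ)
  · intro s _ t _ hst
    have := congrArg l (add_left_cancel hst)
    rwa [hlA, hlA] at this
  · simp only [hφ0]
    exact hbase
  · intro s hs
    rw [(hγ s hs).deriv]
    exact hlne s
  · rw [(hγ 0 h0).deriv, hspan, hψ0]
    have : A (1, 0) = (1 / (ε * (ε + δ))) • (v, ε) := by
      ext <;> simp [hA]
      · field_simp
        linear_combination -h
      · field_simp
    rw [this]
    exact Submodule.span_singleton_smul_eq (IsUnit.mk0 _ (by positivity)) _
  · intro s hs
    rw [(hγ s hs).deriv]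
    refine Submodule.mem_span_singleton.2 ⟨l (F (p + A (s, φ s))), ?_⟩
    have h1 := heq s hs
    have h2 : m (F (p + A (s, φ s))) = l (F (p + A (s, φ s))) * ψ s := by
      simp only at h1
      linarith
    have h3 := hAlm (F (p + A (s, φ s)))
    rw [h2] at h3
    refine Eq.trans ?_ h3
    rw [← map_smul]
    simp

/-! ### The quadratic term along a center manifold -/

/-- The derivative of the remainder is `o(x - a)`, by differentiability of `f'` at `a`; the mean
value inequality integrates this. -/
lemma taylor_two_isLittleO {f : ℝ → ℝ} {a : ℝ} (hf : ContDiffAt ℝ 2 f a) :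
    (fun x => f x - f a - deriv f a * (x - a) - deriv (deriv f) a / 2 * (x - a) ^ 2) =o[𝓝 a]
      fun x => (x - a) ^ 2 := by
  have hd : ∀ᶠ x in 𝓝 a, DifferentiableAt ℝ f x := by
    filter_upwards [hf.eventually (by simp)] with x hx
    exact hx.differentiableAt two_ne_zero
  have hd2 : HasDerivAt (deriv f) (deriv (deriv f) a) a := by
    have : ContDiffAt ℝ 1 (deriv f) a := by
      have h1 : deriv f = fun x => fderiv ℝ f x 1 := funext fun x => fderiv_apply_one_eq_deriv.symm
      rw [h1]
      exact (hf.fderiv_right (m := 1) (by norm_num)).clm_apply contDiffAt_const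
    exact (this.differentiableAt one_ne_zero).hasDerivAt
  rw [Asymptotics.isLittleO_iff]
  intro c hc
  obtain ⟨r, hr, hball⟩ := Metric.eventually_nhds_iff_ball.1
    (hd.and ((Asymptotics.isLittleO_iff.1 (hasDerivAt_iff_isLittleO.1 hd2)) hc))
  filter_upwards [Metric.ball_mem_nhds a hr] with x hx
  have hseg : segment ℝ a x ⊆ Metric.ball a r :=
    (convex_ball a r).segment_subset (Metric.mem_ball_self hr) hx
  have h1 := (convex_segment (𝕜 := ℝ) a x).norm_image_sub_le_of_norm_hasDerivWithin_le
    (f := fun x => f x - f a - deriv f a * (x - a) - deriv (deriv f) a / 2 * (x - a) ^ 2)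
    (f' := fun x => deriv f x - deriv f a - (x - a) * deriv (deriv f) a)
    (C := c * |x - a|) (fun z hz => by
      have h2 := (((hball z (hseg hz)).1.hasDerivAt.sub_const (f a)).sub
        (((hasDerivAt_id z).sub_const a).const_mul (deriv f a))).sub
        ((((hasDerivAt_id z).sub_const a).pow 2).const_mul (deriv (deriv f) a / 2))
      refine (h2.congr_deriv ?_).hasDerivWithinAt
      simp
      ring)
    (fun z hz => (hball z (hseg hz)).2.trans
      (mul_le_mul_of_nonneg_left (norm_sub_le_of_mem_segment hz) hc.le))
    (left_mem_segment ℝ a x) (right_mem_segment ℝ a x)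
  simp only [sub_self, mul_zero, sub_zero, ne_eq, OfNat.ofNat_ne_zero, not_false_eq_true,
    zero_pow] at h1
  refine h1.trans_eq ?_
  rw [norm_pow, Real.norm_eq_abs]
  ring

/-- The first-order term is kept in the form `q s - a`, so differentiability of `q` at `0` is
enough. This matters because center manifolds are only `C¹`. -/
lemma tendsto_taylor_two_comp {f q : ℝ → ℝ} {a q' : ℝ} (hf : ContDiffAt ℝ 2 f a) (hqa : q 0 = a)
    (hq : HasDerivAt q q' 0) :
    Tendsto (fun s => (f (q s) - f a - deriv f a * (q s - a)) / s ^ 2) (𝓝[≠] 0)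
      (𝓝 (deriv (deriv f) a / 2 * q' ^ 2)) := by
  have hq0 : Tendsto q (𝓝 0) (𝓝 a) := hqa ▸ hq.continuousAt
  have hslope : Tendsto (fun s => (q s - a) / s) (𝓝[≠] 0) (𝓝 q') := by
    have := hasDerivAt_iff_tendsto_slope.1 hq
    refine this.congr fun s => ?_
    rw [slope_def_field, hqa, sub_zero]
  have hO : (fun s => (q s - a) ^ 2) =O[𝓝 0] fun s : ℝ => s ^ 2 := by
    have := hq.isBigO_sub
    simp only [hqa, sub_zero] at this
    exact this.pow 2
  have ho := ((taylor_two_isLittleO hf).comp_tendsto hq0).trans_isBigO hO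
  have hlim := (ho.mono (nhdsWithin_le_nhds (s := {0}ᶜ))).tendsto_div_nhds_zero
  have h2 := hlim.add ((hslope.pow 2).const_mul (deriv (deriv f) a / 2))
  rw [zero_add] at h2
  refine h2.congr fun s => ?_
  simp only [Function.comp_apply]
  ring

lemma IsLocalCenterManifold.hasDerivAt {F : ℝ × ℝ → ℝ × ℝ} {p : ℝ × ℝ} {η : ℝ} {γ : ℝ → ℝ × ℝ}
    (h : IsLocalCenterManifold F p η γ) : HasDerivAt γ (deriv γ 0) 0 :=
  ((h.contDiffOn.differentiableOn one_ne_zero).differentiableAt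
    (isOpen_Ioo.mem_nhds ⟨neg_lt_zero.2 h.pos, h.pos⟩)).hasDerivAt

/-- A left null vector of the linearization at a fixed point with vanishing determinant. -/
def leftNull (ε : ℝ) (W : ℝ → ℝ) (p : ℝ × ℝ) : ℝ × ℝ →L[ℝ] ℝ :=
  deriv W p.1 • ContinuousLinearMap.fst ℝ ℝ ℝ + ε • ContinuousLinearMap.snd ℝ ℝ ℝ

lemma IsLocalCenterManifold.exists_deriv_eq {ε δ : ℝ} {V W : ℝ → ℝ} {p : ℝ × ℝ} {η : ℝ}
    {γ : ℝ → ℝ × ℝ} (hγ : IsLocalCenterManifold (field ε δ V W) p η γ) (hε : 0 < ε) (hδ : 0 < δ)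
    (hV : DifferentiableAt ℝ V p.2) (hW : DifferentiableAt ℝ W p.1)
    (h : deriv V p.2 * deriv W p.1 = ε * δ) :
    ∃ c ≠ 0, deriv γ 0 = c • (deriv V p.2, ε) ∧
      leftNull ε W p (deriv γ 0) = c * (ε * (ε + δ)) := by
  have h1 : deriv γ 0 ∈ Submodule.span ℝ {(deriv V p.2, ε)} := by
    rw [← centerSubspace_field_eq_span hε hδ hV hW h, ← hγ.tangent]
    exact Submodule.mem_span_singleton_self _
  obtain ⟨c, hc⟩ := Submodule.mem_span_singleton.1 h1
  refine ⟨c, fun h0 => ?_, hc.symm, ?_⟩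
  · rw [h0, zero_smul] at hc
    exact hγ.deriv_ne_zero 0 ⟨neg_lt_zero.2 hγ.pos, hγ.pos⟩ hc.symm
  · rw [← hc]
    simp [leftNull]
    linear_combination c * h

/-- The left null vector cancels the linear terms exactly, leaving `W'` times the remainder of `V`
plus `ε` times that of `W`. The factors `(cε)²` and `(cV')²` are the squared components of the
velocity. -/
lemma IsLocalCenterManifold.tendsto_leftNull_field {ε δ : ℝ} {V W : ℝ → ℝ} {p : ℝ × ℝ} {η : ℝ}
    {γ : ℝ → ℝ × ℝ} (hγ : IsLocalCenterManifold (field ε δ V W) p η γ)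
    (hV : ContDiffAt ℝ 2 V p.2) (hW : ContDiffAt ℝ 2 W p.1) (hp : field ε δ V W p = 0)
    (hε : ε ≠ 0) (h : deriv V p.2 * deriv W p.1 = ε * δ) {c : ℝ}
    (hc : deriv γ 0 = c • (deriv V p.2, ε)) :
    Tendsto (fun s => leftNull ε W p (field ε δ V W (γ s)) / s ^ 2) (𝓝[≠] 0)
      (𝓝 (c ^ 2 * ε ^ 2 / 2 * (deriv (deriv V) p.2 * deriv W p.1 +
        (1 / ε) * deriv V p.2 ^ 2 * deriv (deriv W) p.1))) := by
  have hd := hγ.hasDerivAt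
  rw [hc] at hd
  have h1 := tendsto_taylor_two_comp hV (by simp [hγ.base]) hd.snd
  have h2 := tendsto_taylor_two_comp hW (by simp [hγ.base]) hd.fst
  have hp1 : V p.2 - ε * p.1 = 0 := congrArg Prod.fst hp
  have hp2 : W p.1 - δ * p.2 = 0 := congrArg Prod.snd hp
  have h3 := (h1.const_mul (deriv W p.1)).add (h2.const_mul ε)
  convert h3 using 2
  · rename_i s
    rw [← mul_div_assoc, ← mul_div_assoc, ← add_div]
    congr 1
    simp [leftNull, field]
    linear_combination deriv W p.1 * hp1 + ε * hp2 + ((γ s).2 - p.2) * h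
  · simp
    field_simp

lemma eventually_sign_of_tendsto {f : ℝ → ℝ} {L k : ℝ}
    (h : Tendsto (fun s => f s / s ^ 2) (𝓝[≠] 0) (𝓝 L)) (hL : 0 < L / k) :
    ∀ᶠ s in 𝓝[>] (0 : ℝ), 0 < f s / k := by
  have h1 := ((h.mono_left (nhdsWithin_mono 0 fun s (hs : 0 < s) => hs.ne')).div_const
    k).eventually_const_lt hL
  filter_upwards [h1, self_mem_nhdsWithin] with s hs hs0
  have h2 : f s / k = f s / s ^ 2 / k * s ^ 2 := by
    have := (mem_Ioi.1 hs0).ne'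
    field_simp
  rw [h2]
  exact mul_pos hs (pow_pos hs0 2)

lemma IsLocalCenterManifold.branches_of_quadratic {ε δ : ℝ} {V W : ℝ → ℝ} {p : ℝ × ℝ} {η : ℝ}
    {γ : ℝ → ℝ × ℝ} (hγ : IsLocalCenterManifold (field ε δ V W) p η γ) (hε : 0 < ε) (hδ : 0 < δ)
    (hV : ContDiffAt ℝ 2 V p.2) (hW : ContDiffAt ℝ 2 W p.1) (hp : field ε δ V W p = 0)
    (h : deriv V p.2 * deriv W p.1 = ε * δ)
    (hQ : deriv (deriv V) p.2 * deriv W p.1 +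
      (1 / ε) * deriv V p.2 ^ 2 * deriv (deriv W) p.1 ≠ 0) :
    (BranchConverges (field ε δ V W) p η γ ∧
        BranchDiverges (field ε δ V W) p η (fun s => γ (-s))) ∨
      (BranchDiverges (field ε δ V W) p η γ ∧
        BranchConverges (field ε δ V W) p η (fun s => γ (-s))) := by
  have hFd : DifferentiableAt ℝ (field ε δ V W) p :=
    (contDiffAt_field hV hW).differentiableAt two_ne_zero
  have hFc : ∀ᶠ q in 𝓝 p, ContinuousAt (field ε δ V W) q := by
    filter_upwards [(contDiffAt_field hV hW).eventually (by simp)] with q hq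
    exact hq.continuousAt
  set Q := deriv (deriv V) p.2 * deriv W p.1 +
    (1 / ε) * deriv V p.2 ^ 2 * deriv (deriv W) p.1 with hQdef
  have key : ∀ γ : ℝ → ℝ × ℝ, IsLocalCenterManifold (field ε δ V W) p η γ →
      ∃ k, leftNull ε W p (deriv γ 0) = k ∧
        (0 < Q * k → BranchDiverges (field ε δ V W) p η γ) ∧
        (Q * k < 0 → BranchConverges (field ε δ V W) p η γ) ∧ k ≠ 0 := by
    intro γ hγ
    obtain ⟨c, hc0, hc, hk⟩ := hγ.exists_deriv_eq hε hδ (hV.differentiableAt two_ne_zero)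
      (hW.differentiableAt two_ne_zero) h
    have hlim := hγ.tendsto_leftNull_field hV hW hp hε.ne' h hc
    have hc2 : 0 < c ^ 2 * ε ^ 2 / 2 := by positivity
    have hk0 : leftNull ε W p (deriv γ 0) ≠ 0 := by
      rw [hk]
      positivity
    refine ⟨_, rfl, fun hpos => ?_, fun hneg => ?_, hk0⟩
    · refine hγ.branchDiverges hp hFd hFc _ hk0 (eventually_sign_of_tendsto hlim ?_)
      rw [mul_div_assoc]
      exact mul_pos hc2 (div_pos_iff.2 (mul_pos_iff.1 hpos))
    · refine hγ.branchConverges hp hFd hFc _ hk0 ?_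
      have hlim' : Tendsto (fun s => -leftNull ε W p (field ε δ V W (γ s)) / s ^ 2) (𝓝[≠] 0)
          (𝓝 (-(c ^ 2 * ε ^ 2 / 2 * Q))) := hlim.neg.congr fun s => (neg_div _ _).symm
      filter_upwards [eventually_sign_of_tendsto (k := leftNull ε W p (deriv γ 0)) hlim' (by
        rw [neg_div, mul_div_assoc, neg_pos]
        exact mul_neg_of_pos_of_neg hc2 (div_neg_iff.2 (mul_neg_iff.1 hneg)))] with s hs
      rwa [neg_div, neg_pos] at hs
  obtain ⟨k, hk, hdiv, hconv, hk0⟩ := key γ hγ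
  obtain ⟨k', hk', hdiv', hconv', -⟩ := key _ hγ.comp_neg
  -- Reversing the curve flips the velocity but not `Q`, so the two branches fall into opposite
  -- cases.
  have hkk : k' = -k := by
    rw [← hk, ← hk', deriv_comp_neg, neg_zero, map_neg]
  rw [hkk, mul_neg] at hdiv' hconv'
  rcases (mul_ne_zero hQ hk0).lt_or_gt with h1 | h1
  · exact Or.inl ⟨hconv h1, hdiv' (neg_pos.2 h1)⟩
  · exact Or.inr ⟨hdiv h1, hconv' (neg_lt_zero.2 h1)⟩

/-! ### Isolation of the fixed points in the square -/

lemma field_eq_zero_iff {ε δ : ℝ} {V W : ℝ → ℝ} {p : ℝ × ℝ} :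
    field ε δ V W p = 0 ↔ ε * p.1 = V p.2 ∧ δ * p.2 = W p.1 := by
  rw [field, Prod.mk_eq_zero, sub_eq_zero, sub_eq_zero, eq_comm, eq_comm (a := W p.1)]

/-- Finitely many fixed points in the square are isolated from one another, and injectivity keeps
the branch away from `p` itself. The branch must stay in the square because zeros of the field
outside it are not controlled. -/
lemma IsLocalCenterManifold.eventually_field_ne_zero {ε δ : ℝ} {V W : ℝ → ℝ} {p : ℝ × ℝ} {η : ℝ}
    {γ : ℝ → ℝ × ℝ} (hγ : IsLocalCenterManifold (field ε δ V W) p η γ)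
    (hfin : (fixedPoints ε δ V W).Finite) (hsq : ∀ᶠ s in 𝓝[>] (0 : ℝ), γ s ∈ square) :
    ∀ᶠ s in 𝓝[>] (0 : ℝ), field ε δ V W (γ s) ≠ 0 := by
  have h0 : (0 : ℝ) ∈ Ioo (-η) η := ⟨neg_lt_zero.2 hγ.pos, hγ.pos⟩
  have hp : Tendsto γ (𝓝[>] 0) (𝓝 p) := by
    have := hγ.hasDerivAt.continuousAt.tendsto
    rw [hγ.base] at this
    exact this.mono_left nhdsWithin_le_nhds
  have hiso : ∀ᶠ q in 𝓝 p, q ∉ fixedPoints ε δ V W \ {p} :=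
    hfin.sdiff.isClosed.isOpen_compl.mem_nhds fun h => h.2 rfl
  filter_upwards [hsq, hp.eventually hiso, Ioo_mem_nhdsGT hγ.pos] with s hs hs' hsη h1
  refine hs' ⟨⟨hs, field_eq_zero_iff.1 h1⟩, fun h2 => hsη.1.ne' ?_⟩
  exact hγ.injOn ⟨by linarith [hsη.1, hγ.pos], hsη.2⟩ h0
    ((mem_singleton_iff.1 h2).trans hγ.base.symm)

end PlatformModel

end

/-! ### The classification theorem -/

theorem theorem1 (ε δ : ℝ) (hε : 1 ≤ ε) (hδ : 1 ≤ δ) (V W : ℝ → ℝ)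
    (hV : ∀ x ∈ Icc (0 : ℝ) 1, ContDiffAt ℝ ∞ V x)
    (hW : ∀ x ∈ Icc (0 : ℝ) 1, ContDiffAt ℝ ∞ W x)
    (hVmaps : MapsTo V (Icc 0 1) (Icc 0 1)) (hWmaps : MapsTo W (Icc 0 1) (Icc 0 1))
    (hV0 : V 0 = 0) (hW0 : W 0 = 0)
    (hfin : (PlatformModel.fixedPoints ε δ V W).Finite) :
    -- the possible types of fixed points
    (∀ p ∈ PlatformModel.fixedPoints ε δ V W,
      (∃ z ∈ PlatformModel.eigenvalues (PlatformModel.field ε δ V W) p, z.re < 0) ∧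
      (PlatformModel.IsStableNode (PlatformModel.field ε δ V W) p ∨
        PlatformModel.IsStableSpiral (PlatformModel.field ε δ V W) p ∨
        PlatformModel.IsSaddle (PlatformModel.field ε δ V W) p ∨
        (PlatformModel.IsSaddleNodeType (PlatformModel.field ε δ V W) p ∧
          -- each branch of a center manifold that lies in the square converges or diverges
          ∀ (η : ℝ) (γ : ℝ → ℝ × ℝ),
            PlatformModel.IsLocalCenterManifold (PlatformModel.field ε δ V W) p η γ →
            ((∀ᶠ s in 𝓝[>] (0 : ℝ), γ s ∈ PlatformModel.square) →
              PlatformModel.BranchConverges (PlatformModel.field ε δ V W) p η γ ∨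
              PlatformModel.BranchDiverges (PlatformModel.field ε δ V W) p η γ) ∧
            ((∀ᶠ s in 𝓝[>] (0 : ℝ), γ (-s) ∈ PlatformModel.square) →
              PlatformModel.BranchConverges (PlatformModel.field ε δ V W) p η
                  (fun s => γ (-s)) ∨
              PlatformModel.BranchDiverges (PlatformModel.field ε δ V W) p η
                  (fun s => γ (-s)))))) ∧
    (∀ b₀ g₀ : ℝ, (b₀, g₀) ∈ PlatformModel.fixedPoints ε δ V W →
      -- stable nodes and spirals
      ((PlatformModel.IsStableNode (PlatformModel.field ε δ V W) (b₀, g₀) ∨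
          PlatformModel.IsStableSpiral (PlatformModel.field ε δ V W) (b₀, g₀)) ↔
        deriv V g₀ * deriv W b₀ < ε * δ) ∧
      -- saddles
      (PlatformModel.IsSaddle (PlatformModel.field ε δ V W) (b₀, g₀) ↔
        deriv V g₀ * deriv W b₀ > ε * δ) ∧
      -- center manifolds
      ((∃ (η : ℝ) (γ : ℝ → ℝ × ℝ),
          PlatformModel.IsLocalCenterManifold (PlatformModel.field ε δ V W) (b₀, g₀) η γ) ↔
        deriv V g₀ * deriv W b₀ = ε * δ) ∧
      -- the two branches of a center manifold
      (deriv V g₀ * deriv W b₀ = ε * δ →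
        deriv (deriv V) g₀ * deriv W b₀
          + (1 / ε) * (deriv V g₀) ^ 2 * deriv (deriv W) b₀ ≠ 0 →
        ∀ (η : ℝ) (γ : ℝ → ℝ × ℝ),
          PlatformModel.IsLocalCenterManifold (PlatformModel.field ε δ V W) (b₀, g₀) η γ →
          (PlatformModel.BranchConverges (PlatformModel.field ε δ V W) (b₀, g₀) η γ ∧
            PlatformModel.BranchDiverges (PlatformModel.field ε δ V W) (b₀, g₀) η
              (fun s => γ (-s))) ∨
          (PlatformModel.BranchDiverges (PlatformModel.field ε δ V W) (b₀, g₀) η γ ∧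
            PlatformModel.BranchConverges (PlatformModel.field ε δ V W) (b₀, g₀) η
              (fun s => γ (-s))))) := by
  have hε0 : 0 < ε := one_pos.trans_le hε
  have hδ0 : 0 < δ := one_pos.trans_le hδ
  have hs : 0 < ε + δ := add_pos hε0 hδ0
  have hreg : ∀ p ∈ PlatformModel.fixedPoints ε δ V W,
      ContDiffAt ℝ 2 V p.2 ∧ ContDiffAt ℝ 2 W p.1 ∧ PlatformModel.field ε δ V W p = 0 :=
    fun p hp => ⟨(hV _ hp.1.2).of_le (by norm_cast),
      (hW _ hp.1.1).of_le (by norm_cast), PlatformModel.field_eq_zero_iff.2 hp.2⟩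
  constructor
  · intro p hp
    obtain ⟨hV2, hW2, hp0⟩ := hreg p hp
    have hVd := hV2.differentiableAt two_ne_zero
    have hWd := hW2.differentiableAt two_ne_zero
    rcases lt_trichotomy (deriv V p.2 * deriv W p.1) (ε * δ) with h | h | h
    · have h1 := (PlatformModel.stable_iff hs hVd hWd).2 h
      exact ⟨PlatformModel.exists_eigenvalue_re_neg (or_assoc.1 (Or.inl h1)),
        or_assoc.1 (Or.inl h1)⟩
    · have h1 := PlatformModel.isSaddleNodeType_of_eq hs hVd hWd h
      refine ⟨PlatformModel.exists_eigenvalue_re_neg (Or.inr (Or.inr (Or.inr h1))),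
        Or.inr (Or.inr (Or.inr ⟨h1, ?_⟩))⟩
      have key : ∀ (η : ℝ) (γ : ℝ → ℝ × ℝ),
          PlatformModel.IsLocalCenterManifold (PlatformModel.field ε δ V W) p η γ →
          (∀ᶠ s in 𝓝[>] (0 : ℝ), γ s ∈ PlatformModel.square) →
          PlatformModel.BranchConverges (PlatformModel.field ε δ V W) p η γ ∨
            PlatformModel.BranchDiverges (PlatformModel.field ε δ V W) p η γ := by
        intro η γ hγ hsq
        obtain ⟨c, hc, -, hk⟩ := hγ.exists_deriv_eq hε0 hδ0 hVd hWd h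
        refine hγ.branchConverges_or_branchDiverges hp0
          ((PlatformModel.contDiffAt_field hV2 hW2).differentiableAt two_ne_zero) ?_
          (PlatformModel.leftNull ε W p) (by rw [hk]; positivity)
          (hγ.eventually_field_ne_zero hfin hsq)
        filter_upwards [(PlatformModel.contDiffAt_field hV2 hW2).eventually (by simp)] with q hq
        exact hq.continuousAt
      exact fun η γ hγ => ⟨key η γ hγ, key η _ hγ.comp_neg⟩
    · have h1 := (PlatformModel.isSaddle_iff hVd hWd).2 h
      exact ⟨PlatformModel.exists_eigenvalue_re_neg (Or.inr (Or.inr (Or.inl h1))),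
        Or.inr (Or.inr (Or.inl h1))⟩
  · intro b₀ g₀ hp
    obtain ⟨hV2, hW2, hp0⟩ := hreg _ hp
    have hVd := hV2.differentiableAt two_ne_zero
    have hWd := hW2.differentiableAt two_ne_zero
    refine ⟨PlatformModel.stable_iff hs hVd hWd, PlatformModel.isSaddle_iff hVd hWd,
      ⟨?_, PlatformModel.exists_isLocalCenterManifold hε0 hδ0 hV2 hW2 hp0⟩,
      fun h hQ η γ hγ => hγ.branches_of_quadratic hε0 hδ0 hV2 hW2 hp0 h hQ⟩
    -- With nonzero determinant the center subspace is trivial and cannot be spanned by a nonzero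
    -- velocity.
    rintro ⟨η, γ, hγ⟩
    by_contra h
    have h1 := hγ.tangent
    rw [PlatformModel.centerSubspace_field_eq_bot hs hVd hWd h,
      Submodule.span_singleton_eq_bot] at h1
    exact hγ.deriv_ne_zero 0 ⟨neg_lt_zero.2 hγ.pos, hγ.pos⟩ h1
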